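/- Let $(Q,g)$ be a smooth $n$-dimensional semi-Riemannian manifold, $M=T^*Q$, and let $(q^i,p_i)$ be the canonical coordinates on $M$ induced by an arbitrary chart of $Q$, with $\omega=dp_j\wedge dq^j$, $\omega^{\mu\nu}$ the inverse matrix of $\omega_{\mu\nu}$. A Latin index $i$ stands for $q^i$, a barred index $\bar i$ for $p_i$, and Greek indices for all $2n$ coordinates $x^\mu$. Let $\tilde\Gamma^k_{ij}$ be the Christoffel symbols of $g$, and let $\nabla$ be the lift of the Levi-Civita connection to $T^*Q$, i.e. the connection with coefficients $$\Gamma^k_{ij}=-\Gamma^{\bar j}_{i\bar k}=-\Gamma^{\bar i}_{\bar kj}=\tilde\Gamma^k_{ij},\qquad \Gamma^{\bar k}_{ij}=\tfrac{p_a}{3}\big(2\tilde\Gamma^a_{jl}\tilde\Gamma^l_{ki}-\partial_j\tilde\Gamma^a_{ki}+\mathrm{cycl.}(ijk)\big),$$ all other ones being zero. Put $\Gamma_{\alpha\beta\gamma}=\omega_{\alpha\lambda}\Gamma^\lambda_{\beta\gamma}$, let $R^\alpha{}_{\beta\mu\nu}$ be the curvature of $\nabla$ and $R_{\alpha\beta\mu\nu}=\omega_{\alpha\lambda}R^\lambda{}_{\beta\mu\nu}$.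 Let $\mathcal W$ be the Weyl bundle of formal series $\sum\hbar^k c_{k,\alpha}\,y^\alpha$ with smooth complex coefficient functions, with generators $y^\mu$ (written $\hat q^i,\hat p_i$), with the Weyl product $\circ$ determined by $y^\mu\circ y^\nu=y^\mu y^\nu+\frac{i\hbar}2\omega^{\mu\nu}$, and extended to $\mathcal W$-valued differential forms. The $\hbar$-degree of $\hbar^k y^{\mu_1}\cdots y^{\mu_l}dx^{\nu_1}\wedge\cdots\wedge dx^{\nu_m}$ is $k+l/2$. Let $\nabla=d+[dU(\Gamma),\cdot\,]$ with $dU(\Gamma)=-\frac{i}{2\hbar}\Gamma_{\alpha\beta\gamma}y^\alpha y^\beta dx^\gamma$, $\hat R=-\frac14R_{\alpha\beta\mu\nu}y^\alpha y^\beta dx^\mu\wedge dx^\nu$, $\delta=dx^\mu\wedge\partial/\partial y^\mu$, $\delta^*=y^\mu\iota(\partial/\partial x^\mu)$, and $\delta^{-1}=\frac1{a+b}\delta^*$ on terms with $a$ factors $y$ and $b$ factors $dx$ ($\delta^{-1}=0$ if $a+b=0$). Define $$r^{(3)}=\delta^{-1}\hat R,\qquad r^{(k+1)}=\delta^{-1}\hat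 R+\delta^{-1}\big(\nabla r^{(k)}+\tfrac i\hbar (r^{(k)})^2\big)\ \mathrm{mod}\ \hbar^{k/2+1}\quad(k\ge3),$$ and $r=\lim_k r^{(k)}$, where $\mathrm{mod}\ \hbar^{s}$ means discarding all terms of $\hbar$-degree $\ge s$, and limits are taken coefficientwise. Let $A=dU(\Gamma)+\frac i\hbar\big(\omega_{\mu\nu}y^\nu dx^\mu+r\big)$ be the connection form of the Fedosov connection $D=d+[A,\cdot\,]=\nabla-\delta+\frac i\hbar[r,\cdot\,]$. For a smooth function $f:T^*Q\to\mathbb C$ (independent of $\hbar$) define $$\hat f^{(0)}=f,\qquad \hat f^{(k+1)}=f+\delta^{-1}\big(\nabla\hat f^{(k)}+\tfrac i\hbar[r,\hat f^{(k)}]\big)\ \mathrm{mod}\ \hbar^{k/2+1}\quad(k\ge0),$$ and $\hat f=\lim_k\hat f^{(k)}$. The $Q$-degree of $y^{\mu_1}\cdots y^{\mu_k}dx^{\nu_1}\wedge\cdots\wedge dx^{\nu_l}$ (with any coefficient in $C^\infty(M)$ and any power of $\hbar$) is the number of $\hat q^j$ minus the number of $\hat p_j$, plus the number of $dq^j$ minus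 the number of $dp_j$. One writes $q(\eta)>m$ (resp. $q(\eta)\ge m$) if every nonzero homogeneous component of $\eta$ has $Q$-degree $>m$ (resp. $\ge m$); in particular this holds for $\eta=0$. Then, over every chart of $Q$, the two limits exist; $r$ is the only possible smooth solution of $\delta r=\hat R+\nabla r+\frac i\hbar r^2$ that satisfies $\delta^{-1}r=0$ and has only terms of $\hbar$-degree $\ge 3/2$; and: - $q(A)\ge0$; - $q\big(A-\frac i\hbar\omega_{\mu\nu}y^\nu dx^\mu\big)>0$; - $q(r-r^{(k)})>k-1$ for all $k\ge3$; - if $f\in C^\infty(T^*Q)$ is a polynomial of degree at most $N$ in $p$, with arbitrary smooth dependence on $q$, then $\hat f$ is the only possible smooth section of $\mathcal W$ with $D\hat f=0$ whose part without any $y$ is $f$, and $q(\hat f-\hat f^{(k)})>k-2N$ for all $k\ge0$. -/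

import Mathlib

open scoped Manifold ContDiff

noncomputable section

namespace FedosovCotangent

/-! ### Semi-Riemannian manifolds, cotangent bundles and canonical coordinates -/

/-- The model space `ℝⁿ` of the configuration manifold. -/
abbrev Model (n : ℕ) : Type := EuclideanSpace ℝ (Fin n)

/-- Index set of the canonical coordinates on `T*Q`: `Sum.inl i` stands for `qⁱ`
(an unbarred index), `Sum.inr i` for `pᵢ` (a barred index). -/
abbrev Idx (n : ℕ) : Type := Fin n ⊕ Fin n

/-- The coordinate space of the canonical coordinates `x = (q, p)`. -/
abbrev Phase (n : ℕ) : Type := Idx n → ℝ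

/-- A smooth semi-Riemannian metric: a smooth field of nondegenerate symmetric bilinear forms
of any signature. -/
structure SemiRiemannianMetric (n : ℕ) (Q : Type*) [TopologicalSpace Q]
    [ChartedSpace (Model n) Q] [IsManifold (𝓡 n) ∞ Q] where
  val (x : Q) : TangentSpace (𝓡 n) x →L[ℝ] TangentSpace (𝓡 n) x →L[ℝ] ℝ
  symm (x : Q) (v w : TangentSpace (𝓡 n) x) : val x v w = val x w v
  nondegenerate (x : Q) (v : TangentSpace (𝓡 n) x) (hv : ∀ w, val x v w = 0) : v = 0
  contMDiff : ContMDiff (𝓡 n) ((𝓡 n).prod 𝓘(ℝ, Model n →L[ℝ] Model n →L[ℝ] ℝ)) ∞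
    (fun x ↦ Bundle.TotalSpace.mk' (Model n →L[ℝ] Model n →L[ℝ] ℝ) x (val x))

/-- The cotangent bundle `T*Q`. -/
abbrev CotangentBundle (n : ℕ) (Q : Type*) [TopologicalSpace Q]
    [ChartedSpace (Model n) Q] [IsManifold (𝓡 n) ∞ Q] : Type _ :=
  Bundle.TotalSpace (Model n →L[ℝ] ℝ) (fun x : Q ↦ TangentSpace (𝓡 n) x →L[ℝ] ℝ)

section Manifold

variable {n : ℕ} {Q : Type*} [TopologicalSpace Q] [ChartedSpace (Model n) Q]
  [IsManifold (𝓡 n) ∞ Q]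

/-- The coefficients `g_{ij} = g(∂ᵢ, ∂ⱼ)` of the metric in the chart `φ`, as functions on
`φ.target`. -/
def SemiRiemannianMetric.coeffs (g : SemiRiemannianMetric n Q)
    (φ : OpenPartialHomeomorph Q (Model n)) (u : Model n) : Matrix (Fin n) (Fin n) ℝ :=
  Matrix.of fun i j ↦ g.val (φ.symm u)
    (mfderiv (𝓡 n) (𝓡 n) φ.symm u (EuclideanSpace.single i (1 : ℝ)))
    (mfderiv (𝓡 n) (𝓡 n) φ.symm u (EuclideanSpace.single j (1 : ℝ)))

/-- The position part `q` of a point `x = (q, p)`. -/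
def position (x : Phase n) : Model n := WithLp.toLp 2 fun i ↦ x (Sum.inl i)

/-- The coordinate domain of `T*Q` over the chart `φ`, i.e. `φ.target × ℝⁿ`. -/
def canonicalDomain (φ : OpenPartialHomeomorph Q (Model n)) : Set (Phase n) :=
  {x | position x ∈ φ.target}

/-- The point of `T*Q` with canonical coordinates `(q, p)`: the covector `∑ pᵢ dφⁱ` at
`φ⁻¹(q)`. -/
def canonicalPoint (φ : OpenPartialHomeomorph Q (Model n)) (x : Phase n) :
    CotangentBundle n Q :=
  ⟨φ.symm (position x), ∑ i : Fin n, x (Sum.inr i) •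
    ((EuclideanSpace.proj i : Model n →L[ℝ] ℝ).comp
      (mfderiv (𝓡 n) (𝓡 n) φ (φ.symm (position x))))⟩

/-- A function on `T*Q` is polynomial of degree (at most) `N` in the momenta, with arbitrary
dependence on the base point: on every fibre it is a polynomial of degree `≤ N` in the linear
fibre coordinates given by any basis of the tangent space. -/
def IsMomentumPolynomial (N : ℕ) (f : CotangentBundle n Q → ℂ) : Prop :=
  ∀ (x : Q) (b : Module.Basis (Fin n) ℝ (TangentSpace (𝓡 n) x)),
    ∃ P : MvPolynomial (Fin n) ℂ, P.totalDegree ≤ N ∧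
      ∀ ξ : TangentSpace (𝓡 n) x →L[ℝ] ℝ,
        f ⟨x, ξ⟩ = MvPolynomial.eval (fun i ↦ ((ξ (b i) : ℝ) : ℂ)) P

end Manifold

/-! ### The lifted connection in canonical coordinates -/

section Connection

variable {n : ℕ}

/-- Partial derivative `∂ᵢ` of a function on the base. -/
def basePartial (i : Fin n) (F : Model n → ℝ) (u : Model n) : ℝ :=
  lineDeriv ℝ F u (EuclideanSpace.single i (1 : ℝ))

/-- Christoffel symbols `Γ̃ᵏᵢⱼ` of the Levi-Civita connection of a metric with coefficient
matrix `G`. -/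
def baseChristoffel (G : Model n → Matrix (Fin n) (Fin n) ℝ) (u : Model n) (k i j : Fin n) : ℝ :=
  (1 / 2 : ℝ) * ∑ l, (G u)⁻¹ k l *
    (basePartial i (fun v ↦ G v j l) u + basePartial j (fun v ↦ G v i l) u
      - basePartial l (fun v ↦ G v i j) u)

/-- The expression `2 Γ̃ᵃⱼₗ Γ̃ˡₖᵢ - ∂ⱼ Γ̃ᵃₖᵢ`. -/
def liftTerm (G : Model n → Matrix (Fin n) (Fin n) ℝ) (u : Model n) (a i j k : Fin n) : ℝ :=
  2 * ∑ l, baseChristoffel G u a j l * baseChristoffel G u l k i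
    - basePartial j (fun v ↦ baseChristoffel G v a k i) u

/-- The coefficients `Γ^κ_{μν}` (arguments `κ μ ν`) of the lift of the Levi-Civita connection
to `T*Q`. -/
def liftedChristoffel (G : Model n → Matrix (Fin n) (Fin n) ℝ) (x : Phase n) :
    Idx n → Idx n → Idx n → ℝ
  | .inl k, .inl i, .inl j => baseChristoffel G (position x) k i j
  | .inr j, .inl i, .inr k => -baseChristoffel G (position x) k i j
  | .inr i, .inr k, .inl j => -baseChristoffel G (position x) k i j
  | .inr k, .inl i, .inl j => ∑ a, x (.inr a) / 3 *
      (liftTerm G (position x) a i j k + liftTerm G (position x) a j k i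
        + liftTerm G (position x) a k i j)
  | _, _, _ => 0

/-- Components `ω_{μν}` of `ω = dpⱼ ∧ dqʲ`, that is `ω_{p q} = 1`, `ω_{q p} = -1`. -/
def symp (n : ℕ) : Matrix (Idx n) (Idx n) ℝ := Matrix.J (Fin n) ℝ

/-- Components `ω^{μν}` of the inverse matrix, that is `ω^{q p} = 1`, `ω^{p q} = -1`. -/
def sympInv (n : ℕ) : Matrix (Idx n) (Idx n) ℝ := (symp n)⁻¹

/-- `Γ_{αβγ} = ω_{αλ} Γ^λ_{βγ}`. -/
def loweredChristoffel (Γ : Phase n → Idx n → Idx n → Idx n → ℝ) (x : Phase n)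
    (α β γ : Idx n) : ℝ :=
  ∑ l, symp n α l * Γ x l β γ

/-- Partial derivative `∂_μ` of a scalar function on phase space. -/
def phasePartial {F : Type*} [NormedAddCommGroup F] [NormedSpace ℝ F]
    (μ : Idx n) (f : Phase n → F) (x : Phase n) : F :=
  lineDeriv ℝ f x (Pi.single μ (1 : ℝ))

/-- Curvature
`R^i_{jkl} = ∂ₖ Γ^i_{lj} - ∂ₗ Γ^i_{kj} + Γ^i_{km} Γ^m_{lj} - Γ^i_{lm} Γ^m_{kj}`. -/
def curvature (Γ : Phase n → Idx n → Idx n → Idx n → ℝ) (x : Phase n)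
    (i j k l : Idx n) : ℝ :=
  phasePartial k (fun z ↦ Γ z i l j) x - phasePartial l (fun z ↦ Γ z i k j) x
    + ∑ m, Γ x i k m * Γ x m l j - ∑ m, Γ x i l m * Γ x m k j

/-- `R_{ijkl} = ω_{im} R^m_{jkl}`. -/
def loweredCurvature (Γ : Phase n → Idx n → Idx n → Idx n → ℝ) (x : Phase n)
    (i j k l : Idx n) : ℝ :=
  ∑ m, symp n i m * curvature Γ x m j k l

end Connection

/-! ### The Weyl algebra -/

section WeylAlgebra

variable {n : ℕ}

/-- Fibre of the Weyl bundle: formal series `∑ ħᵏ c_{k,α} y^α`, as power series in `ħ` whose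
coefficients are power series in the generators `y^μ`. The multiplication of this ring is the
symmetric tensor product; the Weyl product is `weylMul`. -/
abbrev Weyl (n : ℕ) : Type := PowerSeries (MvPowerSeries (Idx n) ℂ)

/-- The coefficient of `ħᵏ y^α`. -/
def wcoeff (k : ℕ) (α : Idx n →₀ ℕ) (a : Weyl n) : ℂ :=
  MvPowerSeries.coeff α (PowerSeries.coeff k a)

/-- The element with given coefficients. -/
def wmk (c : ℕ → (Idx n →₀ ℕ) → ℂ) : Weyl n := PowerSeries.mk fun k α ↦ c k α

/-- Twice the `ħ`-degree `k + |α|/2` of the monomial `ħᵏ y^α`. -/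
def twiceHDeg (k : ℕ) (α : Idx n →₀ ℕ) : ℕ := 2 * k + α.degree

/-- A scalar as an element of the Weyl algebra. -/
def wC (c : ℂ) : Weyl n := PowerSeries.C (MvPowerSeries.C c)

/-- The generator `y^μ`. -/
def gen (μ : Idx n) : Weyl n := PowerSeries.C (MvPowerSeries.X μ)

/-- `∂/∂y^μ`. -/
def yDeriv (μ : Idx n) (a : Weyl n) : Weyl n :=
  PowerSeries.mk fun k ↦ MvPowerSeries.pderiv ℂ μ (PowerSeries.coeff k a)

/-- Iterated derivative `∂/∂y^{I₁} ⋯ ∂/∂y^{Iₘ}`. -/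
def yDerivs {m : ℕ} (I : Fin m → Idx n) (a : Weyl n) : Weyl n :=
  (List.ofFn I).foldr yDeriv a

/-- The Weyl product
`a ∘ b = ∑ₘ (1/m!) (iħ/2)ᵐ ω^{I₁J₁} ⋯ ω^{IₘJₘ} (∂_{I₁}⋯∂_{Iₘ} a) (∂_{J₁}⋯∂_{Jₘ} b)`.
Only the terms `m ≤ K` contribute to the coefficient of `ħᴷ`. -/
def weylMul (a b : Weyl n) : Weyl n :=
  PowerSeries.mk fun K ↦ PowerSeries.coeff K
    (∑ m ∈ Finset.range (K + 1), PowerSeries.X ^ m *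
      (wC ((Complex.I / 2) ^ m / (m.factorial : ℂ)) *
        ∑ I : Fin m → Idx n, ∑ J : Fin m → Idx n,
          wC (((∏ s, sympInv n (I s) (J s) : ℝ)) : ℂ) * (yDerivs I a * yDerivs J b)))

/-- `a ↦ (i/ħ) a`, for elements `a` whose `ħ⁰`-part vanishes (as is the case for all
commutators with respect to `∘`). -/
def iOverH (a : Weyl n) : Weyl n :=
  PowerSeries.mk fun k ↦ MvPowerSeries.C Complex.I * PowerSeries.coeff (k + 1) a

/-- `(i/ħ) [a, b]`, the commutator being taken with respect to the Weyl product. -/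
def adOverH (a b : Weyl n) : Weyl n := iOverH (weylMul a b - weylMul b a)

/-- For symmetric `S_{αβ} = ω_{αγ} A^γ_β` with `A ∈ sp(2n)`, the element
`(ħ/i) dU(A) = -(1/2) S_{αβ} y^α y^β`. -/
def metaplectic (S : Idx n → Idx n → ℝ) : Weyl n :=
  -(wC (1 / 2) * ∑ α, ∑ β, wC ((S α β : ℝ) : ℂ) * (gen α * gen β))

end WeylAlgebra

/-! ### Differential forms with values in the Weyl bundle, in canonical coordinates -/

section Forms

variable {n l : ℕ}

/-- Forms of degree `l` with values in the Weyl bundle, through their (alternating) components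
`ξ_{ν₁…ν_l}`, where `ξ = (1/l!) ξ_{ν₁…ν_l} dx^{ν₁} ∧ ⋯ ∧ dx^{ν_l}`. Only the values over the
coordinate domain matter. -/
abbrev WForm (n l : ℕ) : Type := Phase n → (Fin l → Idx n) → Weyl n

/-- Smoothness of all coefficient functions on `S`. -/
def WForm.IsSmoothOn (S : Set (Phase n)) (ξ : WForm n l) : Prop :=
  ∀ ν k α, ContDiffOn ℝ ∞ (fun x ↦ wcoeff k α (ξ x ν)) S

/-- `∂_μ`, acting on the coefficient functions of a section of the Weyl bundle. -/
def sectionPartial (μ : Idx n) (a : Phase n → Weyl n) (x : Phase n) : Weyl n :=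
  wmk fun k α ↦ phasePartial μ (fun z ↦ wcoeff k α (a z)) x

/-- The induced covariant derivative `∇_μ = ∂_μ + [dU(Γ_μ), ·]` on sections of the Weyl
bundle. -/
def weylCovDeriv (Γ : Phase n → Idx n → Idx n → Idx n → ℝ) (μ : Idx n)
    (a : Phase n → Weyl n) (x : Phase n) : Weyl n :=
  sectionPartial μ a x
    + adOverH (metaplectic fun α β ↦ loweredChristoffel Γ x α β μ) (a x)

/-- The exterior covariant derivative `∇ = dx^μ ∧ ∇_μ`. -/
def nabla (Γ : Phase n → Idx n → Idx n → Idx n → ℝ) (ξ : WForm n l) : WForm n (l + 1) :=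
  fun x ν ↦ ∑ j : Fin (l + 1), (-1 : Weyl n) ^ (j : ℕ) *
    weylCovDeriv Γ (ν j) (fun z ↦ ξ z (fun s ↦ ν (j.succAbove s))) x

/-- `δ = dx^μ ∧ ∂/∂y^μ`. -/
def delta (ξ : WForm n l) : WForm n (l + 1) :=
  fun x ν ↦ ∑ j : Fin (l + 1), (-1 : Weyl n) ^ (j : ℕ) *
    yDeriv (ν j) (ξ x (fun s ↦ ν (j.succAbove s)))

/-- `δ^* = y^μ ι(∂/∂x^μ)`. -/
def deltaStar (ξ : WForm n (l + 1)) : WForm n l :=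
  fun x ν ↦ ∑ μ, gen μ * ξ x (Fin.cons μ ν)

/-- `δ⁻¹`: on a component with `a` factors `y` and `b` factors `dx` it is `δ^*` divided by
`a + b`. This sum is unchanged by `δ^*`, and is read off here from the result. -/
def deltaInv (ξ : WForm n (l + 1)) : WForm n l :=
  fun x ν ↦ wmk fun k α ↦ wcoeff k α (deltaStar ξ x ν) / ((α.degree + l : ℕ) : ℂ)

/-- The product `ξ ∘ η` (i.e. `∘ ⊗ ∧`) of two 1-forms. -/
def mulOneOne (ξ η : WForm n 1) : WForm n 2 :=
  fun x ν ↦ weylMul (ξ x ![ν 0]) (η x ![ν 1]) - weylMul (ξ x ![ν 1]) (η x ![ν 0])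

/-- `(i/ħ) r²` for a 1-form `r`, with `r² = r ∘ r`; the components of `r²` are commutators. -/
def iOverHSq (r : WForm n 1) : WForm n 2 := fun x ν ↦ iOverH (mulOneOne r r x ν)

/-- `(i/ħ) [r, a]` for a 1-form `r` and a 0-form `a`. -/
def iOverHComm (r : WForm n 1) (a : WForm n 0) : WForm n 1 :=
  fun x ν ↦ adOverH (r x ν) (a x ![])

/-- `R̂ = (ħ/i) dU(R) = -(1/4) R_{ijkl} y^i y^j dx^k ∧ dx^l`. -/
def curvatureForm (Γ : Phase n → Idx n → Idx n → Idx n → ℝ) : WForm n 2 :=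
  fun x ν ↦ metaplectic fun α β ↦ loweredCurvature Γ x α β (ν 0) (ν 1)

/-- Reduction modulo `ħ^{m/2}`: discard all terms of `ħ`-degree at least `m/2`. -/
def modH (m : ℕ) (ξ : WForm n l) : WForm n l :=
  fun x ν ↦ wmk fun k α ↦ if twiceHDeg k α < m then wcoeff k α (ξ x ν) else 0

/-- The limit of an iteration `s` whose `k`-th step fixes the terms of `ħ`-degree `≤ k/2`: the
terms of `ħ`-degree `d/2` of the limit are those of `s d`. -/
def iterLimit (s : ℕ → WForm n l) : WForm n l :=
  fun x ν ↦ wmk fun k α ↦ wcoeff k α (s (twiceHDeg k α) x ν)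

/-- `ξ` is the formal limit of `s` over `S`: every coefficient of `s m` is eventually equal to
that of `ξ`. -/
def IsFormalLimitOn (S : Set (Phase n)) (s : ℕ → WForm n l) (ξ : WForm n l) : Prop :=
  ∀ x ∈ S, ∀ ν k α, ∀ᶠ m in Filter.atTop, wcoeff k α (s m x ν) = wcoeff k α (ξ x ν)

end Forms

/-! ### Fedosov's constructions -/

section Fedosov

variable {n : ℕ}

/-- The iterates `r^{(k)}`, `k ≥ 3` (with `r^{(0)} = r^{(1)} = r^{(2)} = r^{(3)}` by
convention): `r^{(3)} = δ⁻¹ R̂` and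
`r^{(k+1)} = δ⁻¹ R̂ + δ⁻¹(∇ r^{(k)} + (i/ħ) (r^{(k)})²) mod ħ^{k/2+1}`. -/
def rIter (Γ : Phase n → Idx n → Idx n → Idx n → ℝ) : ℕ → WForm n 1
  | 0 => deltaInv (curvatureForm Γ)
  | k + 1 => if k < 3 then deltaInv (curvatureForm Γ) else
      modH (k + 2) (deltaInv (curvatureForm Γ)
        + deltaInv (nabla Γ (rIter Γ k) + iOverHSq (rIter Γ k)))

/-- `r = lim r^{(k)}`. -/
def fedosovR (Γ : Phase n → Idx n → Idx n → Idx n → ℝ) : WForm n 1 := iterLimit (rIter Γ)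

/-- `r` is a smooth solution over `S` of `δ r = R̂ + ∇ r + (i/ħ) r²` with `δ⁻¹ r = 0` and
with terms of `ħ`-degree `≥ 3/2` only. -/
def IsFedosovSolutionOn (S : Set (Phase n)) (Γ : Phase n → Idx n → Idx n → Idx n → ℝ)
    (r : WForm n 1) : Prop :=
  r.IsSmoothOn S ∧
  (∀ x ∈ S, ∀ ν k α, wcoeff k α (r x ν) ≠ 0 → 3 ≤ twiceHDeg k α) ∧
  (∀ x ∈ S, deltaInv r x = 0) ∧
  (∀ x ∈ S, delta r x = (curvatureForm Γ + nabla Γ r + iOverHSq r) x)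

/-- Scalar functions as Weyl-bundle-valued 0-forms. -/
def scalarForm (f : Phase n → ℂ) : WForm n 0 := fun x _ ↦ wC (f x)

/-- The iterates `f̂^{(k)}`: `f̂^{(0)} = f` and
`f̂^{(k+1)} = f + δ⁻¹(∇ f̂^{(k)} + (i/ħ) [r, f̂^{(k)}]) mod ħ^{k/2+1}`. -/
def hatIter (Γ : Phase n → Idx n → Idx n → Idx n → ℝ) (f : Phase n → ℂ) : ℕ → WForm n 0
  | 0 => scalarForm f
  | k + 1 => modH (k + 2) (scalarForm f
      + deltaInv (nabla Γ (hatIter Γ f k) + iOverHComm (fedosovR Γ) (hatIter Γ f k)))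

/-- `f̂ = lim f̂^{(k)}`. -/
def hat (Γ : Phase n → Idx n → Idx n → Idx n → ℝ) (f : Phase n → ℂ) : WForm n 0 :=
  iterLimit (hatIter Γ f)

/-- `a` is a smooth section of the Weyl bundle over `S` which is flat, that is
`D a = ∇ a - δ a + (i/ħ) [r, a] = 0`, and whose part `a₀` without any `y` equals `f`. -/
def IsFlatLiftOn (S : Set (Phase n)) (Γ : Phase n → Idx n → Idx n → Idx n → ℝ)
    (f : Phase n → ℂ) (a : WForm n 0) : Prop :=
  a.IsSmoothOn S ∧
  (∀ x ∈ S, (nabla Γ a - delta a + iOverHComm (fedosovR Γ) a) x = 0) ∧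
  (∀ x ∈ S, ∀ k, wcoeff k 0 (a x ![]) = if k = 0 then f x else 0)

/-- Forms of degree `l` whose values may contain negative powers of `ħ`. -/
abbrev LWForm (n l : ℕ) : Type :=
  Phase n → (Fin l → Idx n) → LaurentSeries (MvPowerSeries (Idx n) ℂ)

/-- Inclusion of power series in `ħ` into Laurent series. -/
def WForm.toLaurent {l : ℕ} (ξ : WForm n l) : LWForm n l :=
  fun x ν ↦ HahnSeries.ofPowerSeries ℤ _ (ξ x ν)

/-- The factor `i/ħ`. -/
def iOverHLaurent (n : ℕ) : LaurentSeries (MvPowerSeries (Idx n) ℂ) :=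
  HahnSeries.single (-1 : ℤ) (MvPowerSeries.C Complex.I)

/-- The 1-form `ω_{μν} y^ν dx^μ`. -/
def flatGamma (n : ℕ) : WForm n 1 :=
  fun _ ν ↦ ∑ β, wC ((symp n (ν 0) β : ℝ) : ℂ) * gen β

/-- `γ = ω_{μν} y^ν dx^μ + r`. -/
def fedosovGamma (Γ : Phase n → Idx n → Idx n → Idx n → ℝ) : WForm n 1 :=
  flatGamma n + fedosovR Γ

/-- The 1-form `dU(Γ) = -(i/2ħ) Γ_{αβμ} y^α y^β dx^μ`. -/
def dUGamma (Γ : Phase n → Idx n → Idx n → Idx n → ℝ) : LWForm n 1 :=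
  fun x ν ↦ iOverHLaurent n *
    HahnSeries.ofPowerSeries ℤ _ (metaplectic fun α β ↦ loweredChristoffel Γ x α β (ν 0))

/-- `(i/ħ) ω_{μν} y^ν dx^μ`, the flat part of the connection form. -/
def flatConnectionForm (n : ℕ) : LWForm n 1 :=
  fun x ν ↦ iOverHLaurent n * (flatGamma n).toLaurent x ν

/-- The connection form `A = dU(Γ) + (i/ħ) γ` of the Fedosov connection `D = d + [A, ·]`. -/
def connectionForm (Γ : Phase n → Idx n → Idx n → Idx n → ℝ) : LWForm n 1 :=
  fun x ν ↦ dUGamma Γ x ν + iOverHLaurent n * (fedosovGamma Γ).toLaurent x ν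

end Fedosov

/-! ### The Q-degree -/

section QDegree

variable {n l : ℕ}

/-- `+1` for a `q`-index, `-1` for a `p`-index. -/
def qSign : Idx n → ℤ
  | .inl _ => 1
  | .inr _ => -1

/-- The `Q`-degree of `y^α dx^{ν₁} ∧ ⋯ ∧ dx^{ν_l}`: the number of `q̂ʲ` minus the number of
`p̂ⱼ`, plus the number of `dqʲ` minus the number of `dpⱼ`. -/
def qDegree (α : Idx n →₀ ℕ) (ν : Fin l → Idx n) : ℤ :=
  ∑ μ, (α μ : ℤ) * qSign μ + ∑ j, qSign (ν j)

/-- `q(η) > m` over `S`: every nonvanishing homogeneous component of `η` has `Q`-degree `> m`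
(so this holds for `η = 0`). -/
def QDegGT (S : Set (Phase n)) (η : LWForm n l) (m : ℤ) : Prop :=
  ∀ x ∈ S, ∀ ν (k : ℤ) α,
    MvPowerSeries.coeff α ((η x ν).coeff k) ≠ 0 → m < qDegree α ν

/-- `q(η) ≥ m` over `S`. -/
def QDegGE (S : Set (Phase n)) (η : LWForm n l) (m : ℤ) : Prop :=
  ∀ x ∈ S, ∀ ν (k : ℤ) α,
    MvPowerSeries.coeff α ((η x ν).coeff k) ≠ 0 → m ≤ qDegree α ν

end QDegree

end FedosovCotangent

end

/-!
The two parts of the theorem rest on two filtrations of the Weyl-bundle-valued forms, by lower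
bounds for the `ħ`-degree and for a weight combining the `Q`-degree with the degree in the momenta.

*Convergence and uniqueness.* Write `d` for twice the `ħ`-degree. The operator `∇` preserves `d`,
`δ⁻¹` raises it by one, and `(i/ħ)[·, ·]` adds the values of `d` and subtracts two. As `r` starts
at `d = 3`, the maps `r ↦ δ⁻¹R̂ + δ⁻¹(∇r + (i/ħ)r²)` and `a ↦ f + δ⁻¹(∇a + (i/ħ)[r, a])` improve
any agreement of two arguments by one step in `d` (`rStep_sub_mem`, `hatStep_sub_mem`), so that the
truncated iterations stabilize: the `k`-th iterate is correct up to `d = k` (`iterLimit_sub_mem`).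
By the homotopy formula `δ⁻¹δ + δδ⁻¹ = 1` (`deltaInv_delta_one`, `deltaInv_delta_zero`), a
solution of `δr = R̂ + ∇r + (i/ħ)r²` with `δ⁻¹r = 0`, or a flat section with leading part `f`, is a
fixed point of the corresponding map, and hence equals the limit (`fixedPoint_sub_mem`,
`eq_iterLimit`).

*The `Q`-degree.* The Weyl product contracts a `q` with a `p`, so the `Q`-degree `s` is additive,
but `∇` contains `∂/∂pᵢ dpᵢ`, which lowers it by one. This is compensated by the degree `e` in the
momenta: the weight `s - 2e` is raised by at least one both by `∂/∂q dq` and by `∂/∂p dp`, and also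
by `dU(Γ)`, because the coefficients of the lifted connection have `s = 1`, `e = 0` or `s = 3`,
`e ≤ 1` (`isMomAdapted_liftedChristoffel`). Following the recursion, a component of `r` is
polynomial in the momenta with `s - 2e ≥ d - 1`, and a component of `f̂` has `s - 2e ≥ d - 2N`
(`IsMomAdapted.rIter_mem`, `IsMomAdapted.hatIter_mem`). Since `e ≥ 0` for every nonzero component
and the differences `r - r⁽ᵏ⁾` and `f̂ - f̂⁽ᵏ⁾` only have components with `d ≥ k + 1`, the bounds on
the `Q`-degree follow (`le_qDegree`).

Smoothness of the metric coefficients, their invertibility, and smoothness of the canonical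
parametrization of `T*Q` provide the polynomial dependence on the momenta with smooth coefficients.
-/

noncomputable section

namespace FedosovCotangent


/-! ### Coefficients in the Weyl algebra -/

section Coefficients

variable {n : ℕ}

@[ext]
lemma weyl_ext {a b : Weyl n} (h : ∀ k α, wcoeff k α a = wcoeff k α b) : a = b :=
  PowerSeries.ext fun k ↦ MvPowerSeries.ext fun α ↦ h k α

@[simp] lemma wcoeff_wmk (c : ℕ → (Idx n →₀ ℕ) → ℂ) (k : ℕ) (α : Idx n →₀ ℕ) :
    wcoeff k α (wmk c) = c k α :=
  congrFun (PowerSeries.coeff_mk (R := MvPowerSeries (Idx n) ℂ) k fun k α ↦ c k α) α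

@[simp] lemma wcoeff_add (k : ℕ) (α : Idx n →₀ ℕ) (a b : Weyl n) :
    wcoeff k α (a + b) = wcoeff k α a + wcoeff k α b := by simp [wcoeff]

@[simp] lemma wcoeff_sub (k : ℕ) (α : Idx n →₀ ℕ) (a b : Weyl n) :
    wcoeff k α (a - b) = wcoeff k α a - wcoeff k α b := by simp [wcoeff]

@[simp] lemma wcoeff_neg (k : ℕ) (α : Idx n →₀ ℕ) (a : Weyl n) :
    wcoeff k α (-a) = -wcoeff k α a := by simp [wcoeff]

@[simp] lemma wcoeff_zero (k : ℕ) (α : Idx n →₀ ℕ) : wcoeff k α (0 : Weyl n) = 0 := by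
  simp [wcoeff]

@[simp] lemma wcoeff_sum {ι : Type*} (s : Finset ι) (k : ℕ) (α : Idx n →₀ ℕ) (a : ι → Weyl n) :
    wcoeff k α (∑ i ∈ s, a i) = ∑ i ∈ s, wcoeff k α (a i) := by simp [wcoeff]

lemma wcoeff_mul (k : ℕ) (α : Idx n →₀ ℕ) (a b : Weyl n) :
    wcoeff k α (a * b) = ∑ p ∈ Finset.HasAntidiagonal.antidiagonal k,
      ∑ q ∈ Finset.HasAntidiagonal.antidiagonal α, wcoeff p.1 q.1 a * wcoeff p.2 q.2 b := by
  simp only [wcoeff, PowerSeries.coeff_mul, map_sum, MvPowerSeries.coeff_mul]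

lemma wcoeff_wC (k : ℕ) (α : Idx n →₀ ℕ) (c : ℂ) :
    wcoeff k α (wC c) = if k = 0 ∧ α = 0 then c else 0 := by
  classical
  by_cases hk : k = 0 <;> simp [wcoeff, wC, PowerSeries.coeff_C, MvPowerSeries.coeff_C, hk]

lemma wcoeff_gen (k : ℕ) (α : Idx n →₀ ℕ) (μ : Idx n) :
    wcoeff k α (gen μ) = if k = 0 ∧ α = Finsupp.single μ 1 then 1 else 0 := by
  classical
  by_cases hk : k = 0 <;> simp [wcoeff, gen, PowerSeries.coeff_C, MvPowerSeries.coeff_X, hk]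

lemma wcoeff_gen_mul_add_single (k : ℕ) (α : Idx n →₀ ℕ) (μ : Idx n) (a : Weyl n) :
    wcoeff k (α + Finsupp.single μ 1) (gen μ * a) = wcoeff k α a := by
  simp only [wcoeff, gen, PowerSeries.coeff_C_mul, MvPowerSeries.X]
  rw [add_comm, MvPowerSeries.coeff_add_monomial_mul, one_mul]

lemma wcoeff_gen_mul_of_eq_zero (k : ℕ) (α : Idx n →₀ ℕ) (μ : Idx n) (a : Weyl n)
    (h : α μ = 0) : wcoeff k α (gen μ * a) = 0 := by
  classical
  simp only [wcoeff, gen, PowerSeries.coeff_C_mul, MvPowerSeries.X,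
    MvPowerSeries.coeff_monomial_mul]
  rw [if_neg]
  intro hle
  have := hle μ
  simp [h] at this

lemma wcoeff_X_pow_mul (k m : ℕ) (α : Idx n →₀ ℕ) (a : Weyl n) :
    wcoeff k α (PowerSeries.X ^ m * a) = if m ≤ k then wcoeff (k - m) α a else 0 := by
  simp only [wcoeff, PowerSeries.coeff_X_pow_mul']
  split_ifs <;> simp

@[simp] lemma wcoeff_yDeriv (k : ℕ) (α : Idx n →₀ ℕ) (μ : Idx n) (a : Weyl n) :
    wcoeff k α (yDeriv μ a) = wcoeff k (α + Finsupp.single μ 1) a * (α μ + 1) := by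
  simp [wcoeff, yDeriv, MvPowerSeries.coeff_pderiv]

@[simp] lemma wcoeff_iOverH (k : ℕ) (α : Idx n →₀ ℕ) (a : Weyl n) :
    wcoeff k α (iOverH a) = Complex.I * wcoeff (k + 1) α a := by
  simp [wcoeff, iOverH, MvPowerSeries.coeff_C_mul]

/-! ### Linearity of the Weyl product -/

lemma yDeriv_sub (μ : Idx n) (a b : Weyl n) : yDeriv μ (a - b) = yDeriv μ a - yDeriv μ b := by
  ext k α; simp [sub_mul]

lemma yDerivs_sub {m : ℕ} (I : Fin m → Idx n) (a b : Weyl n) :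
    yDerivs I (a - b) = yDerivs I a - yDerivs I b := by
  unfold yDerivs
  induction List.ofFn I with
  | nil => rfl
  | cons μ t ih => simp only [List.foldr_cons, ih, yDeriv_sub]

lemma weylMul_sub_left (a a' b : Weyl n) :
    weylMul (a - a') b = weylMul a b - weylMul a' b := by
  refine PowerSeries.ext fun K ↦ ?_
  simp only [weylMul, map_sub, PowerSeries.coeff_mk, yDerivs_sub, sub_mul, mul_sub,
    Finset.sum_sub_distrib]

lemma weylMul_sub_right (a b b' : Weyl n) :
    weylMul a (b - b') = weylMul a b - weylMul a b' := by
  refine PowerSeries.ext fun K ↦ ?_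
  simp only [weylMul, map_sub, PowerSeries.coeff_mk, yDerivs_sub, mul_sub,
    Finset.sum_sub_distrib]

lemma iOverH_sub (a b : Weyl n) : iOverH (a - b) = iOverH a - iOverH b := by
  ext k α; simp [mul_sub]

lemma adOverH_sub_right (a b b' : Weyl n) :
    adOverH a (b - b') = adOverH a b - adOverH a b' := by
  simp only [adOverH, weylMul_sub_right, weylMul_sub_left, iOverH_sub]
  abel

lemma sympInv_apply (μ ν : Idx n) : sympInv n μ ν = -symp n μ ν := by
  have h : sympInv n = -symp n := Matrix.J_inv (Fin n) ℝ
  rw [h, Matrix.neg_apply]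

/-- The form `ω` pairs only a `q`-index with a `p`-index. -/
lemma symp_ne_zero {μ ν : Idx n} (h : symp n μ ν ≠ 0) :
    ∃ i, μ = .inl i ∧ ν = .inr i ∨ μ = .inr i ∧ ν = .inl i := by
  rcases μ with i | i <;> rcases ν with j | j <;>
    simp [symp, Matrix.J, Matrix.one_apply] at h ⊢ <;> exact h.symm

end Coefficients

/-! ### Weighted filtrations -/

/-- A filtration of the algebra of functions `X → ℂ` by subspaces `level t`, together with
compatible weights of the generators `y^μ` and of `ħ`. The weights of `qⁱ` and `pᵢ` sum to that
of `ħ`, which makes the Weyl product compatible with the filtration. -/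
structure WeightedFiltration (n : ℕ) (X : Type*) where
  level : ℤ → Submodule ℂ (X → ℂ)
  mono : Monotone level
  one_mem : 1 ∈ level 0
  mul_mem : ∀ {s t : ℤ} {f g : X → ℂ}, f ∈ level s → g ∈ level t → f * g ∈ level (s + t)
  weight : Idx n → ℤ
  weightH : ℤ
  weight_pair : ∀ i, weight (.inl i) + weight (.inr i) = weightH

namespace WeightedFiltration

variable {n : ℕ} {X : Type*} (P : WeightedFiltration n X)

/-- The weight of the monomial `ħᵏ y^α`. -/
def deg (k : ℕ) (α : Idx n →₀ ℕ) : ℤ := P.weightH * k + ∑ μ, (α μ : ℤ) * P.weight μ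

/-- Families of Weyl algebra elements in which the coefficient of each monomial `ħᵏ y^α` lies in
the level `deg k α + c`. -/
def weylLevel (c : ℤ) : AddSubgroup (X → Weyl n) where
  carrier := {a | ∀ k α, (fun x ↦ wcoeff k α (a x)) ∈ P.level (P.deg k α + c)}
  zero_mem' k α := by
    simp only [Pi.zero_apply, wcoeff_zero]
    exact (P.level _).zero_mem
  add_mem' ha hb k α := by
    simp only [Pi.add_apply, wcoeff_add]
    exact (P.level _).add_mem (ha k α) (hb k α)
  neg_mem' ha k α := by
    simp only [Pi.neg_apply, wcoeff_neg]
    exact (P.level _).neg_mem (ha k α)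

variable {P}

lemma deg_add (k l : ℕ) (α β : Idx n →₀ ℕ) :
    P.deg (k + l) (α + β) = P.deg k α + P.deg l β := by
  simp only [deg, Finsupp.add_apply, Nat.cast_add, add_mul, Finset.sum_add_distrib]
  ring

lemma deg_single (μ : Idx n) : P.deg 0 (Finsupp.single μ 1) = P.weight μ := by
  classical
  simp only [deg, Finsupp.single_apply, Nat.cast_zero, mul_zero, zero_add]
  simp

@[simp] lemma deg_zero : P.deg 0 0 = 0 := by simp [deg]

lemma deg_add_single (k : ℕ) (α : Idx n →₀ ℕ) (μ : Idx n) :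
    P.deg k (α + Finsupp.single μ 1) = P.deg k α + P.weight μ := by
  have := P.deg_add k 0 α (Finsupp.single μ 1)
  rwa [deg_single, add_zero] at this

lemma deg_succ (k : ℕ) (α : Idx n →₀ ℕ) : P.deg (k + 1) α = P.deg k α + P.weightH := by
  simp only [deg]; push_cast; ring

lemma weylLevel_mono {c d : ℤ} (h : c ≤ d) {a : X → Weyl n} (ha : a ∈ P.weylLevel c) :
    a ∈ P.weylLevel d := fun k α ↦ P.mono (by omega) (ha k α)

lemma sum_mem {ι : Type*} {s : Finset ι} {c : ℤ} {a : ι → X → Weyl n}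
    (h : ∀ i ∈ s, a i ∈ P.weylLevel c) : (fun x ↦ ∑ i ∈ s, a i x) ∈ P.weylLevel c := by
  have := AddSubgroup.sum_mem _ h
  rwa [Finset.sum_fn] at this

lemma level_sum_mem {ι : Type*} {s : Finset ι} {c : ℤ} {a : ι → X → ℂ}
    (h : ∀ i ∈ s, a i ∈ P.level c) : (fun x ↦ ∑ i ∈ s, a i x) ∈ P.level c := by
  have := Submodule.sum_mem _ h
  rwa [Finset.sum_fn] at this

lemma mul_mem_weylLevel {c d : ℤ} {a b : X → Weyl n} (ha : a ∈ P.weylLevel c)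
    (hb : b ∈ P.weylLevel d) : (fun x ↦ a x * b x) ∈ P.weylLevel (c + d) := by
  intro k α
  simp only [wcoeff_mul]
  refine level_sum_mem fun p hp ↦ level_sum_mem fun q hq ↦ ?_
  rw [← Finset.HasAntidiagonal.mem_antidiagonal.1 hp,
    ← Finset.HasAntidiagonal.mem_antidiagonal.1 hq, P.deg_add]
  have := P.mul_mem (ha p.1 q.1) (hb p.2 q.2)
  refine P.mono (le_of_eq ?_) this
  ring

lemma wC_mem {t : ℤ} {f : X → ℂ} (hf : f ∈ P.level t) : (fun x ↦ wC (f x)) ∈ P.weylLevel t := by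
  intro k α
  simp only [wcoeff_wC]
  by_cases h : k = 0 ∧ α = 0
  · simpa [h.1, h.2] using! hf
  · simp only [h, if_false]
    exact (P.level _).zero_mem

lemma const_mem (c : ℂ) : (fun _ : X ↦ c) ∈ P.level 0 := by
  have := (P.level 0).smul_mem c P.one_mem
  convert this using 1
  ext; simp

lemma gen_mem (μ : Idx n) : (fun _ : X ↦ gen μ) ∈ P.weylLevel (-P.weight μ) := by
  intro k α
  simp only [wcoeff_gen]
  by_cases h : k = 0 ∧ α = Finsupp.single μ 1
  · simp only [h, and_self, if_true, deg_single, add_neg_cancel]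
    exact P.const_mem 1
  · simp only [h, if_false]
    exact (P.level _).zero_mem

lemma wC_mul_mem (r : ℂ) {c : ℤ} {a : X → Weyl n} (ha : a ∈ P.weylLevel c) :
    (fun x ↦ wC r * a x) ∈ P.weylLevel c := by
  have := mul_mem_weylLevel (wC_mem (P.const_mem r)) ha
  rwa [zero_add] at this

lemma neg_one_pow_mul_mem (m : ℕ) {c : ℤ} {a : X → Weyl n} (ha : a ∈ P.weylLevel c) :
    (fun x ↦ (-1) ^ m * a x) ∈ P.weylLevel c := by
  rcases neg_one_pow_eq_or (Weyl n) m with h | h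
  · simpa [h] using ha
  · simp only [h, neg_one_mul]
    exact (P.weylLevel c).neg_mem ha

lemma yDeriv_mem (μ : Idx n) {c : ℤ} {a : X → Weyl n} (ha : a ∈ P.weylLevel c) :
    (fun x ↦ yDeriv μ (a x)) ∈ P.weylLevel (c + P.weight μ) := by
  intro k α
  simp only [wcoeff_yDeriv]
  have := (P.level _).smul_mem ((α μ : ℂ) + 1) (ha k (α + Finsupp.single μ 1))
  rw [deg_add_single] at this
  refine P.mono (le_of_eq (by ring)) (?_ : _ ∈ P.level (P.deg k α + P.weight μ + c))
  convert this using 1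
  exact funext fun x ↦ mul_comm (wcoeff k (α + Finsupp.single μ 1) (a x)) _

lemma yDerivs_mem {m : ℕ} (I : Fin m → Idx n) {c : ℤ} {a : X → Weyl n}
    (ha : a ∈ P.weylLevel c) :
    (fun x ↦ yDerivs I (a x)) ∈ P.weylLevel (c + ∑ s, P.weight (I s)) := by
  have key : ∀ L : List (Idx n), (fun x ↦ L.foldr yDeriv (a x)) ∈
      P.weylLevel (c + (L.map P.weight).sum) := by
    intro L
    induction L with
    | nil => simpa using ha
    | cons μ t ih =>
      have := yDeriv_mem μ ih
      refine weylLevel_mono (le_of_eq ?_) this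
      simp only [List.map_cons, List.sum_cons]; ring
  have := key (List.ofFn I)
  rwa [List.map_ofFn, List.sum_ofFn] at this

lemma X_pow_mul_mem (m : ℕ) {c : ℤ} {a : X → Weyl n} (ha : a ∈ P.weylLevel c) :
    (fun x ↦ PowerSeries.X ^ m * a x) ∈ P.weylLevel (c - m * P.weightH) := by
  intro k α
  simp only [wcoeff_X_pow_mul]
  split_ifs with h
  · refine P.mono (le_of_eq ?_) (ha (k - m) α)
    simp only [deg, Nat.cast_sub h]; ring
  · exact (P.level _).zero_mem

lemma weight_add_of_symp_ne_zero {μ ν : Idx n} (h : symp n μ ν ≠ 0) :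
    P.weight μ + P.weight ν = P.weightH := by
  obtain ⟨i, ⟨rfl, rfl⟩ | ⟨rfl, rfl⟩⟩ := symp_ne_zero h
  · exact P.weight_pair i
  · rw [add_comm]; exact P.weight_pair i

/-- Each contraction with `ω^{μν}` lowers the weight by that of `ħ`, which is restored by the
accompanying factor `ħ`. -/
lemma weylMul_mem {c d : ℤ} {a b : X → Weyl n} (ha : a ∈ P.weylLevel c)
    (hb : b ∈ P.weylLevel d) : (fun x ↦ weylMul (a x) (b x)) ∈ P.weylLevel (c + d) := by
  intro K α
  -- The coefficient of `ħᴷ` is that of a partial sum, which can be treated termwise.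
  have key : (fun x ↦ ∑ m ∈ Finset.range (K + 1), PowerSeries.X ^ m *
      (wC ((Complex.I / 2) ^ m / (m.factorial : ℂ)) *
        ∑ I : Fin m → Idx n, ∑ J : Fin m → Idx n,
          wC (((∏ s, sympInv n (I s) (J s) : ℝ)) : ℂ) * (yDerivs I (a x) * yDerivs J (b x)))) ∈
      P.weylLevel (c + d) := by
    refine sum_mem fun m _ ↦ ?_
    have h2 : (fun x ↦ ∑ I : Fin m → Idx n, ∑ J : Fin m → Idx n,
          wC (((∏ s, sympInv n (I s) (J s) : ℝ)) : ℂ) *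
            (yDerivs I (a x) * yDerivs J (b x))) ∈ P.weylLevel (c + d + m * P.weightH) := by
      refine sum_mem fun I _ ↦ sum_mem fun J _ ↦ ?_
      by_cases h0 : (∏ s, sympInv n (I s) (J s) : ℝ) = 0
      · simp only [h0, Complex.ofReal_zero, wC, map_zero, zero_mul]
        exact (P.weylLevel _).zero_mem
      · refine wC_mul_mem _ (weylLevel_mono (le_of_eq ?_)
          (mul_mem_weylLevel (yDerivs_mem I ha) (yDerivs_mem J hb)))
        have hs : ∑ s, P.weight (I s) + ∑ s, P.weight (J s) = m * P.weightH := by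
          rw [← Finset.sum_add_distrib, Finset.sum_congr rfl fun s _ ↦ ?_]
          · rw [Finset.sum_const, Finset.card_univ, Fintype.card_fin, nsmul_eq_mul]
          · have := Finset.prod_ne_zero_iff.1 h0 s (Finset.mem_univ _)
            rw [sympInv_apply, neg_ne_zero] at this
            exact weight_add_of_symp_ne_zero this
        linarith
    have h3 := X_pow_mul_mem m (wC_mul_mem ((Complex.I / 2) ^ m / (m.factorial : ℂ)) h2)
    exact weylLevel_mono (by linarith) h3
  have := key K α
  simpa only [wcoeff, weylMul, PowerSeries.coeff_mk] using this

lemma iOverH_mem {c : ℤ} {a : X → Weyl n} (ha : a ∈ P.weylLevel c) :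
    (fun x ↦ iOverH (a x)) ∈ P.weylLevel (c + P.weightH) := by
  intro k α
  simp only [wcoeff_iOverH]
  refine P.mono (le_of_eq ?_) ((P.level _).smul_mem Complex.I (ha (k + 1) α))
  rw [deg_succ]; ring

lemma adOverH_mem {c d : ℤ} {a b : X → Weyl n} (ha : a ∈ P.weylLevel c)
    (hb : b ∈ P.weylLevel d) :
    (fun x ↦ adOverH (a x) (b x)) ∈ P.weylLevel (c + d + P.weightH) := by
  have h1 := weylMul_mem ha hb
  have h2 := weylMul_mem hb ha
  rw [add_comm] at h2
  exact iOverH_mem ((P.weylLevel _).sub_mem h1 h2)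

lemma metaplectic_mem {e : ℤ} {F : X → Idx n → Idx n → ℝ}
    (hF : ∀ α β, (fun x ↦ ((F x α β : ℝ) : ℂ)) ∈ P.level (e + P.weight α + P.weight β)) :
    (fun x ↦ metaplectic (F x)) ∈ P.weylLevel e := by
  refine (P.weylLevel e).neg_mem (wC_mul_mem _ (sum_mem fun α _ ↦ sum_mem fun β _ ↦ ?_))
  refine weylLevel_mono (le_of_eq ?_) (mul_mem_weylLevel (wC_mem (hF α β))
    (mul_mem_weylLevel (gen_mem α) (gen_mem β)))
  ring

end WeightedFiltration


/-! ### Filtrations of Weyl-bundle-valued forms -/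

/-- A weighted filtration on functions on phase space, extended to forms by weights of the `dx^μ`
which differ from those of the `y^μ` by a constant `gap`, such that `∂_μ` changes the level by
`formWeight μ - derivDrop`. -/
structure FormFiltration (n : ℕ) extends WeightedFiltration n (Phase n) where
  formWeight : Idx n → ℤ
  gap : ℤ
  formWeight_eq : ∀ μ, formWeight μ = weight μ + gap
  derivDrop : ℤ
  deriv_mem : ∀ {t : ℤ} {f : Phase n → ℂ} (μ : Idx n), f ∈ level t →
    phasePartial μ f ∈ level (t + formWeight μ - derivDrop)

namespace FormFiltration

variable {n l : ℕ} (P : FormFiltration n)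

/-- Forms all of whose components `ξ_ν` lie in the level `c` shifted by the weight of `dx^ν`. -/
def formLevel (l : ℕ) (c : ℤ) : AddSubgroup (WForm n l) where
  carrier := {ξ | ∀ ν, (fun x ↦ ξ x ν) ∈ P.weylLevel (c + ∑ j, P.formWeight (ν j))}
  zero_mem' ν k α := by
    simp only [Pi.zero_apply, wcoeff_zero]
    exact (P.level _).zero_mem
  add_mem' ha hb ν k α := by
    simp only [Pi.add_apply, wcoeff_add]
    exact (P.level _).add_mem (ha ν k α) (hb ν k α)
  neg_mem' ha ν k α := by
    simp only [Pi.neg_apply, wcoeff_neg]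
    exact (P.level _).neg_mem (ha ν k α)

variable {P}

open WeightedFiltration

lemma formLevel_mono {c d : ℤ} (h : c ≤ d) {ξ : WForm n l} (hξ : ξ ∈ P.formLevel l c) :
    ξ ∈ P.formLevel l d := fun ν ↦ weylLevel_mono (by omega) (hξ ν)

lemma modH_mem (m : ℕ) {c : ℤ} {ξ : WForm n l} (hξ : ξ ∈ P.formLevel l c) :
    modH m ξ ∈ P.formLevel l c := by
  intro ν k α
  simp only [modH, wcoeff_wmk]
  split_ifs
  · exact hξ ν k α
  · exact (P.level _).zero_mem

lemma deltaStar_mem {c : ℤ} {ξ : WForm n (l + 1)} (hξ : ξ ∈ P.formLevel (l + 1) c) :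
    deltaStar ξ ∈ P.formLevel l (c + P.gap) := by
  intro ν
  refine WeightedFiltration.sum_mem fun μ _ ↦ weylLevel_mono (le_of_eq ?_)
    (mul_mem_weylLevel (gen_mem μ) (hξ (Fin.cons μ ν)))
  rw [Fin.sum_univ_succ]
  simp only [Fin.cons_zero, Fin.cons_succ, P.formWeight_eq μ]
  ring

lemma deltaInv_mem {c : ℤ} {ξ : WForm n (l + 1)} (hξ : ξ ∈ P.formLevel (l + 1) c) :
    deltaInv ξ ∈ P.formLevel l (c + P.gap) := by
  intro ν k α
  simp only [deltaInv, wcoeff_wmk]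
  convert (P.level _).smul_mem (((α.degree + l : ℕ) : ℂ)⁻¹) (deltaStar_mem hξ ν k α) using 1
  exact funext fun x ↦ div_eq_inv_mul _ _

lemma sectionPartial_mem (μ : Idx n) {c : ℤ} {a : Phase n → Weyl n} (ha : a ∈ P.weylLevel c) :
    sectionPartial μ a ∈ P.weylLevel (c + P.formWeight μ - P.derivDrop) := by
  intro k α
  simp only [sectionPartial, wcoeff_wmk]
  exact P.mono (le_of_eq (by ring)) (P.deriv_mem μ (ha k α))

/-- The condition that the connection coefficients have the weight for which `∇_μ` and `∂_μ`
change the levels by the same amount. -/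
def IsAdapted (P : FormFiltration n) (Γ : Phase n → Idx n → Idx n → Idx n → ℝ) : Prop :=
  ∀ μ, (fun x ↦ metaplectic fun α β ↦ loweredChristoffel Γ x α β μ) ∈
    P.weylLevel (P.formWeight μ - P.derivDrop - P.weightH)

lemma nabla_mem {Γ : Phase n → Idx n → Idx n → Idx n → ℝ} (hΓ : P.IsAdapted Γ) {c : ℤ}
    {ξ : WForm n l} (hξ : ξ ∈ P.formLevel l c) :
    nabla Γ ξ ∈ P.formLevel (l + 1) (c - P.derivDrop) := by
  intro ν
  refine WeightedFiltration.sum_mem fun j _ ↦ neg_one_pow_mul_mem _ ?_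
  have h := hξ fun s ↦ ν (j.succAbove s)
  refine (P.weylLevel _).add_mem (weylLevel_mono (le_of_eq ?_) (sectionPartial_mem (ν j) h))
    (weylLevel_mono (le_of_eq ?_) (adOverH_mem (hΓ (ν j)) h))
  · rw [Fin.sum_univ_succAbove _ j]; ring
  · rw [Fin.sum_univ_succAbove _ j]; ring

lemma iOverHSq_mem {c : ℤ} {r : WForm n 1} (hr : r ∈ P.formLevel 1 c) :
    iOverHSq r ∈ P.formLevel 2 (c + c + P.weightH) := by
  intro ν
  have h0 := hr ![ν 0]
  have h1 := hr ![ν 1]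
  simp only [Fin.sum_univ_two, Fin.sum_univ_one, Matrix.cons_val_fin_one] at h0 h1 ⊢
  refine weylLevel_mono (le_of_eq ?_) (iOverH_mem ((P.weylLevel _).sub_mem (weylMul_mem h0 h1)
    (weylLevel_mono (le_of_eq ?_) (weylMul_mem h1 h0))))
  · ring
  · ring

lemma iOverHComm_mem {c d : ℤ} {r : WForm n 1} (hr : r ∈ P.formLevel 1 c) {a : WForm n 0}
    (ha : a ∈ P.formLevel 0 d) :
    iOverHComm r a ∈ P.formLevel 1 (c + d + P.weightH) := by
  intro ν
  have h := ha ![]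
  simp only [Finset.univ_eq_empty, Finset.sum_empty] at h
  exact weylLevel_mono (le_of_eq (by ring)) (adOverH_mem (hr ν) h)

lemma scalarForm_mem {t : ℤ} {f : Phase n → ℂ} (hf : f ∈ P.level t) :
    scalarForm f ∈ P.formLevel 0 t := by
  intro ν
  exact weylLevel_mono (by simp) (wC_mem hf)

end FormFiltration

/-! ### The filtration by the `ħ`-degree -/

section HDegree

variable {n l : ℕ}

lemma phasePartial_congr_of_isOpen {F : Type*} [NormedAddCommGroup F] [NormedSpace ℝ F]
    {S : Set (Phase n)} (hS : IsOpen S) {f g : Phase n → F} (h : ∀ x ∈ S, f x = g x) (μ : Idx n)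
    {x : Phase n} (hx : x ∈ S) : phasePartial μ f x = phasePartial μ g x := by
  have : f =ᶠ[nhds x] g := by
    filter_upwards [hS.mem_nhds hx] with z hz using h z hz
  exact this.lineDeriv_eq

/-- The filtration for which `formLevel (-d)` consists of the forms which over `S` have only
terms of `ħ`-degree at least `d/2`. Its levels contain all functions for `t ≥ 0`, and for `t < 0`
those that vanish over `S`. -/
def hFiltration (S : Set (Phase n)) (hS : IsOpen S) : FormFiltration n where
  level t :=
    { carrier := {f | t < 0 → ∀ x ∈ S, f x = 0}
      zero_mem' := fun _ _ _ ↦ rfl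
      add_mem' := fun hf hg ht x hx ↦ by simp [hf ht x hx, hg ht x hx]
      smul_mem' := fun c f hf ht x hx ↦ by simp [hf ht x hx] }
  mono s t hst f hf ht := hf (lt_of_le_of_lt hst ht)
  one_mem h := absurd h (lt_irrefl _)
  mul_mem {s t f g} hf hg hst x hx := by
    rcases lt_or_ge s 0 with hs | hs
    · simp [hf hs x hx]
    · simp [hg (by omega) x hx]
  weight _ := 1
  weightH := 2
  weight_pair _ := rfl
  formWeight _ := 0
  gap := -1
  formWeight_eq _ := rfl
  derivDrop := 0
  deriv_mem {t f} μ hf ht x hx := by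
    rw [phasePartial_congr_of_isOpen hS (hf (by simpa using ht)) μ hx]
    simp [phasePartial, lineDeriv]

variable {S : Set (Phase n)} {hS : IsOpen S}


lemma hFiltration_deg (k : ℕ) (α : Idx n →₀ ℕ) :
    (hFiltration S hS).deg k α = (twiceHDeg k α : ℤ) := by
  simp [WeightedFiltration.deg, hFiltration, twiceHDeg, Finsupp.degree_eq_sum]

lemma mem_hFiltration_formLevel {d : ℤ} {ξ : WForm n l} :
    ξ ∈ (hFiltration S hS).formLevel l (-d) ↔
      ∀ x ∈ S, ∀ ν k α, (twiceHDeg k α : ℤ) < d → wcoeff k α (ξ x ν) = 0 := by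
  have h : ∀ k α (ν : Fin l → Idx n), (hFiltration S hS).deg k α +
      (-d + ∑ j, (hFiltration S hS).formWeight (ν j)) = twiceHDeg k α - d := by
    intro k α ν
    rw [hFiltration_deg]
    simp [hFiltration, sub_eq_add_neg]
  constructor
  · intro H x hx ν k α hd
    have := H ν k α
    rw [h] at this
    exact this (by omega) x hx
  · intro H ν k α
    rw [h]
    exact fun hd x hx ↦ H x hx ν k α (by omega)

lemma hFiltration_all (ξ : WForm n l) : ξ ∈ (hFiltration S hS).formLevel l 0 := by
  have := (mem_hFiltration_formLevel (S := S) (hS := hS) (d := 0) (ξ := ξ)).2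
    fun x _ ν k α h ↦ absurd h (by omega)
  simpa using this

lemma isAdapted_hFiltration (Γ : Phase n → Idx n → Idx n → Idx n → ℝ) :
    (hFiltration S hS).IsAdapted Γ :=
  fun μ ↦ WeightedFiltration.metaplectic_mem fun α β h ↦ absurd h (by simp [hFiltration])

lemma curvatureForm_mem_hFiltration (Γ : Phase n → Idx n → Idx n → Idx n → ℝ) :
    curvatureForm Γ ∈ (hFiltration S hS).formLevel 2 (-2) :=
  fun ν ↦ WeightedFiltration.metaplectic_mem fun α β h ↦ absurd h (by simp [hFiltration])

/-- Terms which differ only in `ħ`-degree at least `d/2` have covariant derivatives with this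
property. No smoothness is needed, as `∂_μ` acts coefficientwise. -/
lemma nabla_sub_mem (Γ : Phase n → Idx n → Idx n → Idx n → ℝ) {d : ℤ} {ξ η : WForm n l}
    (h : ξ - η ∈ (hFiltration S hS).formLevel l (-d)) :
    nabla Γ ξ - nabla Γ η ∈ (hFiltration S hS).formLevel (l + 1) (-d) := by
  intro ν
  have hcongr : (fun x ↦ (nabla Γ ξ - nabla Γ η) x ν) = fun x ↦ ∑ j : Fin (l + 1),
      (-1 : Weyl n) ^ (j : ℕ) * ((sectionPartial (ν j) (fun z ↦ ξ z (fun s ↦ ν (j.succAbove s))) x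
        - sectionPartial (ν j) (fun z ↦ η z (fun s ↦ ν (j.succAbove s))) x)
        + adOverH (metaplectic fun α β ↦ loweredChristoffel Γ x α β (ν j))
          ((ξ - η) x (fun s ↦ ν (j.succAbove s)))) := by
    funext x
    simp only [nabla, Pi.sub_apply, weylCovDeriv, adOverH_sub_right, ← Finset.sum_sub_distrib,
      ← mul_sub]
    refine Finset.sum_congr rfl fun j _ ↦ ?_
    congr 1
    abel
  rw [hcongr]
  refine WeightedFiltration.sum_mem fun j _ ↦ WeightedFiltration.neg_one_pow_mul_mem _ ?_
  refine AddSubgroup.add_mem _ (fun k α hd x hx ↦ ?_) ?_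
  · simp only [sectionPartial, wcoeff_sub, wcoeff_wmk, sub_eq_zero]
    refine phasePartial_congr_of_isOpen hS (fun z hz ↦ ?_) _ hx
    have := mem_hFiltration_formLevel.1 h z hz (fun s ↦ ν (j.succAbove s)) k α ?_
    · rwa [Pi.sub_apply, Pi.sub_apply, wcoeff_sub, sub_eq_zero] at this
    · rw [hFiltration_deg] at hd
      simp only [hFiltration, Finset.sum_const_zero] at hd
      omega
  · refine WeightedFiltration.weylLevel_mono (le_of_eq ?_) (WeightedFiltration.adOverH_mem
      (isAdapted_hFiltration Γ (ν j)) (h fun s ↦ ν (j.succAbove s)))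
    simp [hFiltration]

end HDegree


/-! ### The operators `δ` and `δ⁻¹` -/

section Homotopy

variable {n l : ℕ}

lemma deltaInv_sub (ξ η : WForm n (l + 1)) : deltaInv (ξ - η) = deltaInv ξ - deltaInv η := by
  funext x ν
  ext k α
  simp [deltaInv, deltaStar, mul_sub, sub_div]

lemma wcoeff_gen_mul_yDeriv (μ : Idx n) (a : Weyl n) (k : ℕ) (α : Idx n →₀ ℕ) :
    wcoeff k α (gen μ * yDeriv μ a) = α μ * wcoeff k α a := by
  by_cases h : α μ = 0
  · rw [wcoeff_gen_mul_of_eq_zero _ _ _ _ h, h]; simp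
  · have hα : α = (α - Finsupp.single μ 1) + Finsupp.single μ 1 := by
      rw [tsub_add_cancel_of_le]
      exact Finsupp.single_le_iff.2 (Nat.one_le_iff_ne_zero.2 h)
    generalize α - Finsupp.single μ 1 = β at hα
    subst hα
    rw [wcoeff_gen_mul_add_single, wcoeff_yDeriv]
    simp [mul_comm]

/-- Euler's identity. -/
lemma wcoeff_sum_gen_mul_yDeriv (a : Weyl n) (k : ℕ) (α : Idx n →₀ ℕ) :
    wcoeff k α (∑ μ, gen μ * yDeriv μ a) = α.degree * wcoeff k α a := by
  simp only [wcoeff_sum, wcoeff_gen_mul_yDeriv, ← Finset.sum_mul, Finsupp.degree_eq_sum]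
  push_cast; rfl

lemma yDeriv_gen_mul (μ ν : Idx n) (a : Weyl n) :
    yDeriv ν (gen μ * a) = (if μ = ν then a else 0) + gen μ * yDeriv ν a := by
  classical
  refine PowerSeries.ext fun k ↦ ?_
  simp only [yDeriv, gen, PowerSeries.coeff_mk, PowerSeries.coeff_C_mul, map_add,
    Derivation.leibniz, smul_eq_mul]
  by_cases h : μ = ν
  · subst h; simp [add_comm]
  · simp [h]

lemma deltaInv_delta_zero (a : WForm n 0) (x : Phase n) (k : ℕ) (α : Idx n →₀ ℕ)
    (ν : Fin 0 → Idx n) :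
    wcoeff k α (deltaInv (delta a) x ν) = if α = 0 then 0 else wcoeff k α (a x ν) := by
  have h : deltaStar (delta a) x ν = ∑ μ, gen μ * yDeriv μ (a x ν) := by
    refine Finset.sum_congr rfl fun μ _ ↦ ?_
    congr 1
    simp only [delta, Fin.sum_univ_succ, Fin.cons_zero, Finset.univ_eq_empty, Finset.sum_empty,
      add_zero, Fin.val_zero, pow_zero, one_mul]
    congr 2
  simp only [deltaInv, wcoeff_wmk, h, wcoeff_sum_gen_mul_yDeriv, add_zero]
  by_cases hα : α = 0
  · simp [hα]
  · have : (α.degree : ℂ) ≠ 0 := by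
      rw [Nat.cast_ne_zero]; exact fun h ↦ hα ((Finsupp.degree_eq_zero_iff α).1 h)
    rw [if_neg hα]; field_simp

lemma deltaStar_eq_zero_of_deltaInv {r : WForm n 1} {x : Phase n} (h : deltaInv r x = 0) :
    deltaStar r x = 0 := by
  funext ν
  ext k α
  by_cases hα : α = 0
  · subst hα
    simp only [deltaStar, wcoeff_sum, Pi.zero_apply, wcoeff_zero]
    exact Finset.sum_eq_zero fun μ _ ↦ wcoeff_gen_mul_of_eq_zero _ _ _ _ rfl
  · have h1 := congrArg (wcoeff k α) (congrFun h ν)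
    simp only [deltaInv, wcoeff_wmk, Pi.zero_apply, wcoeff_zero, div_eq_zero_iff,
      Nat.cast_eq_zero, add_zero, Finsupp.degree_eq_zero_iff] at h1
    simpa [hα] using h1

/-- The homotopy formula `δ⁻¹ δ + δ δ⁻¹ = 1` for 1-forms in the kernel of `δ⁻¹`. -/
lemma deltaInv_delta_one {r : WForm n 1} {x : Phase n} (h : deltaInv r x = 0) :
    deltaInv (delta r) x = r x := by
  have hstar := deltaStar_eq_zero_of_deltaInv h
  funext ν
  have h1 : deltaStar (delta r) x ν = (∑ μ, gen μ * yDeriv μ (r x ν)) + r x ν := by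
    have h2 : ∀ μ, delta r x (Fin.cons μ ν) = yDeriv μ (r x ν) - yDeriv (ν 0) (r x ![μ]) := by
      intro μ
      have e0 : (fun s ↦ (Fin.cons μ ν : Fin 2 → Idx n) ((0 : Fin 2).succAbove s)) = ν := by
        funext s
        rw [Subsingleton.elim s 0]; rfl
      have e1 : (fun s ↦ (Fin.cons μ ν : Fin 2 → Idx n) ((1 : Fin 2).succAbove s)) = ![μ] := by
        funext s
        rw [Subsingleton.elim s 0]; rfl
      refine (Fin.sum_univ_two _).trans ?_
      rw [e0, e1, Fin.val_zero, Fin.val_one, pow_zero, pow_one, one_mul, neg_one_mul,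
        ← sub_eq_add_neg]
      rfl
    -- The derivative of `δ* r = 0`; the term in which it hits `y^μ` is the extra summand `r_ν`.
    have h3 : ∑ μ, yDeriv (ν 0) (gen μ * r x ![μ]) = 0 := by
      have h4 := congrArg (yDeriv (ν 0)) (congrFun hstar ![])
      have h5 : yDeriv (ν 0) (deltaStar r x ![]) = ∑ μ, yDeriv (ν 0) (gen μ * r x ![μ]) := by
        ext k α
        simp only [deltaStar, wcoeff_yDeriv, wcoeff_sum, Finset.sum_mul]
        rfl
      rw [← h5, h4]
      ext k α
      simp
    have h6 : r x ν = r x ![ν 0] := by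
      congr 1
      funext s
      rw [Subsingleton.elim s 0]; rfl
    simp only [yDeriv_gen_mul, Finset.sum_add_distrib, Finset.sum_ite_eq', Finset.mem_univ,
      if_true] at h3
    rw [← h6] at h3
    simp only [deltaStar, h2, mul_sub, Finset.sum_sub_distrib]
    rw [sub_eq_add_neg, eq_neg_of_add_eq_zero_right h3, neg_neg]
  ext k α
  simp only [deltaInv, wcoeff_wmk, h1, wcoeff_add, wcoeff_sum_gen_mul_yDeriv]
  have : ((α.degree + 1 : ℕ) : ℂ) ≠ 0 := Nat.cast_ne_zero.2 (Nat.succ_ne_zero _)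
  push_cast at this ⊢
  field_simp

end Homotopy

/-! ### Convergence of the iterations -/

section Iteration

variable {n l : ℕ} {S : Set (Phase n)} {hS : IsOpen S}

lemma sub_modH_mem (m : ℕ) (ξ : WForm n l) :
    modH m ξ - ξ ∈ (hFiltration S hS).formLevel l (-m) := by
  refine mem_hFiltration_formLevel.2 fun x _ ν k α h ↦ ?_
  have : twiceHDeg k α < m := by exact_mod_cast h
  simp [modH, this]

/-- If `F` improves agreement by one step of `ħ`-degree `1/2`, then the `m`-th step of the truncated
iteration of `F` is a fixed point of `F` up to terms of `ħ`-degree at least `(m + 1)/2`. -/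
lemma sub_step_mem {M : Set (WForm n l)} {F : WForm n l → WForm n l}
    (hF : ∀ a ∈ M, ∀ b ∈ M, ∀ d : ℤ, a - b ∈ (hFiltration S hS).formLevel l (-d) →
      F a - F b ∈ (hFiltration S hS).formLevel l (-(d + 1)))
    {s : ℕ → WForm n l} {m₀ : ℕ} (hM : ∀ m ≥ m₀, s m ∈ M)
    (hs : ∀ m ≥ m₀, s (m + 1) = modH (m + 2) (F (s m)))
    (h0 : s m₀ - F (s m₀) ∈ (hFiltration S hS).formLevel l (-(m₀ + 1 : ℤ))) (m : ℕ) (hm : m₀ ≤ m) :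
    s m - F (s m) ∈ (hFiltration S hS).formLevel l (-(m + 1 : ℤ)) := by
  induction m, hm using Nat.le_induction with
  | base => exact h0
  | succ m hm ih =>
    have h1 : s (m + 1) - F (s m) ∈ (hFiltration S hS).formLevel l (-((m + 2 : ℕ) : ℤ)) := by
      rw [hs m hm]; exact sub_modH_mem _ _
    have h2 : s m - s (m + 1) ∈ (hFiltration S hS).formLevel l (-(m + 1 : ℤ)) := by
      have := AddSubgroup.sub_mem _ ih (FormFiltration.formLevel_mono (by push_cast; omega) h1)
      rwa [sub_sub_sub_cancel_right] at this
    have h3 := hF _ (hM m hm) _ (hM (m + 1) (by omega)) _ h2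
    have h4 := AddSubgroup.add_mem _
      (FormFiltration.formLevel_mono (d := -(m + 1 + 1 : ℤ)) (by push_cast; omega) h1) h3
    rw [sub_add_sub_cancel] at h4
    exact_mod_cast h4

lemma sub_succ_mem {F : WForm n l → WForm n l} {s : ℕ → WForm n l} {m : ℕ}
    (hs : s (m + 1) = modH (m + 2) (F (s m)))
    (h : s m - F (s m) ∈ (hFiltration S hS).formLevel l (-(m + 1 : ℤ))) :
    s m - s (m + 1) ∈ (hFiltration S hS).formLevel l (-(m + 1 : ℤ)) := by
  have h1 : s (m + 1) - F (s m) ∈ (hFiltration S hS).formLevel l (-((m + 2 : ℕ) : ℤ)) := by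
    rw [hs]; exact sub_modH_mem _ _
  have := AddSubgroup.sub_mem _ h (FormFiltration.formLevel_mono (by push_cast; omega) h1)
  rwa [sub_sub_sub_cancel_right] at this

/-- A fixed point of `F` over `S` that agrees with the initial step of the truncated iteration to
the expected order agrees with every later one to the order expected there. -/
lemma fixedPoint_sub_mem {M : Set (WForm n l)} {F : WForm n l → WForm n l}
    (hF : ∀ a ∈ M, ∀ b ∈ M, ∀ d : ℤ, a - b ∈ (hFiltration S hS).formLevel l (-d) →
      F a - F b ∈ (hFiltration S hS).formLevel l (-(d + 1)))
    {s : ℕ → WForm n l} {m₀ : ℕ} (hM : ∀ m ≥ m₀, s m ∈ M)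
    (hs : ∀ m ≥ m₀, s (m + 1) = modH (m + 2) (F (s m))) {a : WForm n l} (ha : a ∈ M)
    (hfix : ∀ d : ℤ, a - F a ∈ (hFiltration S hS).formLevel l (-d))
    (h0 : a - s m₀ ∈ (hFiltration S hS).formLevel l (-(m₀ + 1 : ℤ))) (m : ℕ) (hm : m₀ ≤ m) :
    a - s m ∈ (hFiltration S hS).formLevel l (-(m + 1 : ℤ)) := by
  induction m, hm using Nat.le_induction with
  | base => exact h0
  | succ m hm ih =>
    have h1 : s (m + 1) - F (s m) ∈ (hFiltration S hS).formLevel l (-((m + 2 : ℕ) : ℤ)) := by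
      rw [hs m hm]; exact sub_modH_mem _ _
    have h3 := AddSubgroup.add_mem _ (hfix _) (hF _ ha _ (hM m hm) _ ih)
    rw [sub_add_sub_cancel] at h3
    have h4 := AddSubgroup.sub_mem _ h3
      (FormFiltration.formLevel_mono (d := -(m + 1 + 1 : ℤ)) (by push_cast; omega) h1)
    rw [sub_sub_sub_cancel_right] at h4
    exact_mod_cast h4

lemma sub_mem_of_le {s : ℕ → WForm n l}
    (h : ∀ m : ℕ, s m - s (m + 1) ∈ (hFiltration S hS).formLevel l (-(m + 1 : ℤ))) {m m' : ℕ}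
    (hm : m ≤ m') : s m - s m' ∈ (hFiltration S hS).formLevel l (-(m + 1 : ℤ)) := by
  induction m', hm using Nat.le_induction with
  | base => rw [sub_self]; exact AddSubgroup.zero_mem _
  | succ j hj ih =>
    have := AddSubgroup.add_mem _ ih (FormFiltration.formLevel_mono (by omega) (h j))
    rwa [sub_add_sub_cancel] at this

lemma wcoeff_eq_of_sub_mem {ξ η : WForm n l} {d : ℤ}
    (h : ξ - η ∈ (hFiltration S hS).formLevel l (-d)) {x : Phase n} (hx : x ∈ S)
    (ν : Fin l → Idx n) {k : ℕ} {α : Idx n →₀ ℕ} (hd : (twiceHDeg k α : ℤ) < d) :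
    wcoeff k α (ξ x ν) = wcoeff k α (η x ν) := by
  have := mem_hFiltration_formLevel.1 h x hx ν k α hd
  rwa [Pi.sub_apply, Pi.sub_apply, wcoeff_sub, sub_eq_zero] at this

lemma iterLimit_sub_mem {s : ℕ → WForm n l}
    (h : ∀ m : ℕ, s m - s (m + 1) ∈ (hFiltration S hS).formLevel l (-(m + 1 : ℤ))) (m : ℕ) :
    iterLimit s - s m ∈ (hFiltration S hS).formLevel l (-(m + 1 : ℤ)) := by
  refine mem_hFiltration_formLevel.2 fun x hx ν k α hd ↦ ?_
  simp only [Pi.sub_apply, wcoeff_sub, iterLimit, wcoeff_wmk, sub_eq_zero]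
  exact wcoeff_eq_of_sub_mem (sub_mem_of_le h (by omega)) hx ν (by omega)

lemma isFormalLimitOn_iterLimit {s : ℕ → WForm n l}
    (h : ∀ m : ℕ, s m - s (m + 1) ∈ (hFiltration S hS).formLevel l (-(m + 1 : ℤ))) :
    IsFormalLimitOn S s (iterLimit s) := by
  intro x hx ν k α
  filter_upwards [Filter.eventually_ge_atTop (twiceHDeg k α)] with m hm
  exact (wcoeff_eq_of_sub_mem (iterLimit_sub_mem h m) hx ν (by omega)).symm

lemma eq_iterLimit {s : ℕ → WForm n l}
    (h : ∀ m : ℕ, s m - s (m + 1) ∈ (hFiltration S hS).formLevel l (-(m + 1 : ℤ))) {a : WForm n l}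
    {m₀ : ℕ} (ha : ∀ m ≥ m₀, a - s m ∈ (hFiltration S hS).formLevel l (-(m + 1 : ℤ)))
    {x : Phase n} (hx : x ∈ S) : a x = iterLimit s x := by
  funext ν
  ext k α
  have h1 : (twiceHDeg k α : ℤ) < (max m₀ (twiceHDeg k α) : ℕ) + 1 := by omega
  rw [wcoeff_eq_of_sub_mem (ha (max m₀ (twiceHDeg k α)) (le_max_left _ _)) hx ν h1,
    wcoeff_eq_of_sub_mem (iterLimit_sub_mem h _) hx ν h1]

lemma iterLimit_mem {P : FormFiltration n} {s : ℕ → WForm n l} {c : ℤ}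
    (h : ∀ m, s m ∈ P.formLevel l c) : iterLimit s ∈ P.formLevel l c := by
  intro ν k α
  simp only [iterLimit, wcoeff_wmk]
  exact h _ ν k α

end Iteration

/-! ### The iterations for `r` and `f̂` -/

section Fedosov

variable {n : ℕ} {S : Set (Phase n)} {hS : IsOpen S}
  {Γ : Phase n → Idx n → Idx n → Idx n → ℝ}

/-- The map whose fixed point is `r`. -/
def rStep (Γ : Phase n → Idx n → Idx n → Idx n → ℝ) (r : WForm n 1) : WForm n 1 :=
  deltaInv (curvatureForm Γ) + deltaInv (nabla Γ r + iOverHSq r)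

/-- The map whose fixed point is `f̂`. -/
def hatStep (Γ : Phase n → Idx n → Idx n → Idx n → ℝ) (f : Phase n → ℂ) (a : WForm n 0) :
    WForm n 0 :=
  scalarForm f + deltaInv (nabla Γ a + iOverHComm (fedosovR Γ) a)

lemma rIter_of_le {k : ℕ} (hk : k ≤ 3) : rIter Γ k = deltaInv (curvatureForm Γ) := by
  cases k with
  | zero => rfl
  | succ k => rw [rIter, if_pos (by omega)]

lemma rIter_succ {k : ℕ} (hk : 3 ≤ k) : rIter Γ (k + 1) = modH (k + 2) (rStep Γ (rIter Γ k)) := by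
  rw [rIter, if_neg (by omega)]; rfl

lemma hatIter_succ (f : Phase n → ℂ) (k : ℕ) :
    hatIter Γ f (k + 1) = modH (k + 2) (hatStep Γ f (hatIter Γ f k)) := rfl

/-- The iterates of `r` stay in the level `c` of the first one if `δ⁻¹ ∇` does not raise levels and
the quadratic term does not leave the level `c`. -/
lemma rIter_mem {P : FormFiltration n} (hΓ : P.IsAdapted Γ) {c : ℤ}
    (hc : deltaInv (curvatureForm Γ) ∈ P.formLevel 1 c) (h1 : P.gap ≤ P.derivDrop)
    (h2 : c + P.weightH + P.gap ≤ 0) (k : ℕ) : rIter Γ k ∈ P.formLevel 1 c := by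
  induction k with
  | zero => exact hc
  | succ k ih =>
    rcases le_or_gt (k + 1) 3 with hk | hk
    · rwa [rIter_of_le hk]
    · rw [rIter_succ (by omega)]
      refine FormFiltration.modH_mem _ (AddSubgroup.add_mem _ hc ?_)
      refine FormFiltration.formLevel_mono (le_of_eq (sub_add_cancel c P.gap)) <|
        FormFiltration.deltaInv_mem (AddSubgroup.add_mem _
          (FormFiltration.formLevel_mono ?_ (FormFiltration.nabla_mem hΓ ih))
          (FormFiltration.formLevel_mono ?_ (FormFiltration.iOverHSq_mem ih)))
      · omega
      · omega

lemma hatIter_mem {P : FormFiltration n} (hΓ : P.IsAdapted Γ) {c d : ℤ} {f : Phase n → ℂ}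
    (hf : f ∈ P.level d) (hr : fedosovR Γ ∈ P.formLevel 1 c) (h1 : P.gap ≤ P.derivDrop)
    (h2 : c + P.weightH + P.gap ≤ 0) (k : ℕ) : hatIter Γ f k ∈ P.formLevel 0 d := by
  induction k with
  | zero => exact FormFiltration.scalarForm_mem hf
  | succ k ih =>
    rw [hatIter_succ]
    refine FormFiltration.modH_mem _ (AddSubgroup.add_mem _ (FormFiltration.scalarForm_mem hf) ?_)
    refine FormFiltration.formLevel_mono (le_of_eq (sub_add_cancel d P.gap)) <|
      FormFiltration.deltaInv_mem (AddSubgroup.add_mem _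
        (FormFiltration.formLevel_mono ?_ (FormFiltration.nabla_mem hΓ ih))
        (FormFiltration.formLevel_mono ?_ (FormFiltration.iOverHComm_mem hr ih)))
    · omega
    · omega

lemma deltaInv_curvatureForm_mem :
    deltaInv (curvatureForm Γ) ∈ (hFiltration S hS).formLevel 1 (-3) :=
  FormFiltration.formLevel_mono (by simp [hFiltration])
    (FormFiltration.deltaInv_mem (curvatureForm_mem_hFiltration Γ))

lemma rIter_mem_hFiltration (k : ℕ) : rIter Γ k ∈ (hFiltration S hS).formLevel 1 (-3) :=
  rIter_mem (isAdapted_hFiltration Γ) deltaInv_curvatureForm_mem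
    (by simp [hFiltration]) (by simp [hFiltration]) k

lemma fedosovR_mem_hFiltration : fedosovR Γ ∈ (hFiltration S hS).formLevel 1 (-3) :=
  iterLimit_mem rIter_mem_hFiltration

/-- The quadratic term is Lipschitz: `r r' - s s' = (r - s) r' + s (r' - s')`. -/
lemma iOverHSq_sub_mem {r s : WForm n 1} {c d : ℤ} {P : FormFiltration n}
    (hr : r ∈ P.formLevel 1 c) (hs : s ∈ P.formLevel 1 c) (h : r - s ∈ P.formLevel 1 d) :
    iOverHSq r - iOverHSq s ∈ P.formLevel 2 (c + d + P.weightH) := by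
  intro ν
  have hsub : ∀ ν, (fun x ↦ r x ν - s x ν) ∈ P.weylLevel (d + ∑ j, P.formWeight (ν j)) := h
  have r0 := hr ![ν 0]
  have r1 := hr ![ν 1]
  have s0 := hs ![ν 0]
  have s1 := hs ![ν 1]
  have d0 := hsub ![ν 0]
  have d1 := hsub ![ν 1]
  simp only [Fin.sum_univ_two, Fin.sum_univ_one, Matrix.cons_val_fin_one] at r0 r1 s0 s1 d0 d1 ⊢
  have hcongr : (fun x ↦ (iOverHSq r - iOverHSq s) x ν) = fun x ↦ iOverH
      ((weylMul (r x ![ν 0] - s x ![ν 0]) (r x ![ν 1])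
        + weylMul (s x ![ν 0]) (r x ![ν 1] - s x ![ν 1]))
       - (weylMul (r x ![ν 1] - s x ![ν 1]) (r x ![ν 0])
        + weylMul (s x ![ν 1]) (r x ![ν 0] - s x ![ν 0]))) := by
    funext x
    simp only [Pi.sub_apply, iOverHSq, mulOneOne, weylMul_sub_left, weylMul_sub_right,
      sub_add_sub_cancel, ← iOverH_sub]
    rw [sub_sub_sub_comm]
  rw [hcongr]
  refine WeightedFiltration.weylLevel_mono (le_of_eq ?_) (WeightedFiltration.iOverH_mem
    (c := c + d + (P.formWeight (ν 0) + P.formWeight (ν 1)))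
    (AddSubgroup.sub_mem _
      (AddSubgroup.add_mem _
        (WeightedFiltration.weylLevel_mono ?_ (WeightedFiltration.weylMul_mem d0 r1))
        (WeightedFiltration.weylLevel_mono ?_ (WeightedFiltration.weylMul_mem s0 d1)))
      (AddSubgroup.add_mem _
        (WeightedFiltration.weylLevel_mono ?_ (WeightedFiltration.weylMul_mem d1 r0))
        (WeightedFiltration.weylLevel_mono ?_ (WeightedFiltration.weylMul_mem s1 d0)))))
  all_goals omega

lemma rStep_sub_mem {r s : WForm n 1} (hr : r ∈ (hFiltration S hS).formLevel 1 (-3))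
    (hs : s ∈ (hFiltration S hS).formLevel 1 (-3)) (d : ℤ)
    (h : r - s ∈ (hFiltration S hS).formLevel 1 (-d)) :
    rStep Γ r - rStep Γ s ∈ (hFiltration S hS).formLevel 1 (-(d + 1)) := by
  rw [rStep, rStep, add_sub_add_left_eq_sub, ← deltaInv_sub, add_sub_add_comm]
  refine FormFiltration.formLevel_mono (le_of_eq ?_) (FormFiltration.deltaInv_mem (c := -d)
    (AddSubgroup.add_mem _ (nabla_sub_mem Γ h)
      (FormFiltration.formLevel_mono ?_ (iOverHSq_sub_mem hr hs h))))
  · simp only [hFiltration]; ring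
  · simp only [hFiltration]; omega

lemma hatStep_sub_mem {f : Phase n → ℂ} {a b : WForm n 0} (d : ℤ)
    (h : a - b ∈ (hFiltration S hS).formLevel 0 (-d)) :
    hatStep Γ f a - hatStep Γ f b ∈ (hFiltration S hS).formLevel 0 (-(d + 1)) := by
  rw [hatStep, hatStep, add_sub_add_left_eq_sub, ← deltaInv_sub, add_sub_add_comm]
  have hcomm : iOverHComm (fedosovR Γ) a - iOverHComm (fedosovR Γ) b =
      iOverHComm (fedosovR Γ) (a - b) := by
    funext x ν
    simp only [Pi.sub_apply, iOverHComm, adOverH_sub_right]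
  rw [hcomm]
  refine FormFiltration.formLevel_mono (le_of_eq ?_) (FormFiltration.deltaInv_mem (c := -d)
    (AddSubgroup.add_mem _ (nabla_sub_mem Γ h)
      (FormFiltration.formLevel_mono ?_ (FormFiltration.iOverHComm_mem fedosovR_mem_hFiltration h))))
  · simp only [hFiltration]; ring
  · simp only [hFiltration]; omega

lemma rStep_sub_deltaInv_mem {r : WForm n 1} (hr : r ∈ (hFiltration S hS).formLevel 1 (-3)) :
    rStep Γ r - deltaInv (curvatureForm Γ) ∈ (hFiltration S hS).formLevel 1 (-4) := by
  rw [rStep, add_sub_cancel_left]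
  refine FormFiltration.formLevel_mono ?_ (FormFiltration.deltaInv_mem (c := -3)
    (AddSubgroup.add_mem _
      (FormFiltration.formLevel_mono ?_ (FormFiltration.nabla_mem (isAdapted_hFiltration Γ) hr))
      (FormFiltration.formLevel_mono ?_ (FormFiltration.iOverHSq_mem hr))))
  · simp [hFiltration]
  · simp [hFiltration]
  · simp [hFiltration]

lemma hatStep_sub_scalarForm_mem {f : Phase n → ℂ} {a : WForm n 0} :
    hatStep Γ f a - scalarForm f ∈ (hFiltration S hS).formLevel 0 (-1) := by
  rw [hatStep, add_sub_cancel_left]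
  exact FormFiltration.formLevel_mono (by simp [hFiltration])
    (FormFiltration.deltaInv_mem (hFiltration_all _))

lemma rIter_sub_succ_mem (m : ℕ) :
    rIter Γ m - rIter Γ (m + 1) ∈ (hFiltration S hS).formLevel 1 (-(m + 1 : ℤ)) := by
  rcases lt_or_ge m 3 with hm | hm
  · rw [rIter_of_le hm.le, rIter_of_le hm, sub_self]
    exact AddSubgroup.zero_mem _
  · refine sub_succ_mem (rIter_succ hm) (sub_step_mem (m₀ := 3)
      (M := (hFiltration S hS).formLevel 1 (-3)) (fun a ha b hb d ↦ rStep_sub_mem ha hb d)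
      (fun m _ ↦ rIter_mem_hFiltration m) (fun m hm ↦ rIter_succ hm) ?_ m hm)
    -- The recursion starts at `r⁽³⁾ = δ⁻¹ R̂`, which lacks only terms of `ħ`-degree at least `2`.
    rw [← neg_sub, rIter_of_le le_rfl]
    exact AddSubgroup.neg_mem _ (rStep_sub_deltaInv_mem deltaInv_curvatureForm_mem)

lemma hatIter_sub_succ_mem (f : Phase n → ℂ) (m : ℕ) :
    hatIter Γ f m - hatIter Γ f (m + 1) ∈ (hFiltration S hS).formLevel 0 (-(m + 1 : ℤ)) := by
  refine sub_succ_mem (hatIter_succ f m) (sub_step_mem (m₀ := 0)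
    (M := Set.univ) (fun a _ b _ d ↦ hatStep_sub_mem d)
    (fun m _ ↦ Set.mem_univ _) (fun m _ ↦ hatIter_succ f m) ?_ m (Nat.zero_le m))
  rw [← neg_sub]
  exact AddSubgroup.neg_mem _ hatStep_sub_scalarForm_mem

lemma deltaInv_apply_congr {l : ℕ} {ξ η : WForm n (l + 1)} {x : Phase n} (h : ξ x = η x) :
    deltaInv ξ x = deltaInv η x := by
  funext ν
  simp only [deltaInv, deltaStar, h]

lemma sub_mem_of_eqOn {l : ℕ} {ξ η : WForm n l} (h : ∀ x ∈ S, ξ x = η x) (d : ℤ) :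
    ξ - η ∈ (hFiltration S hS).formLevel l (-d) :=
  mem_hFiltration_formLevel.2 fun x hx ν k α _ ↦ by simp [h x hx]

lemma deltaInv_add {l : ℕ} (ξ η : WForm n (l + 1)) :
    deltaInv (ξ + η) = deltaInv ξ + deltaInv η := by
  funext x ν
  ext k α
  simp [deltaInv, deltaStar, mul_add, add_div, Finset.sum_add_distrib]

include hS in
theorem IsFedosovSolutionOn.eq_fedosovR {r : WForm n 1} (h : IsFedosovSolutionOn S Γ r)
    {x : Phase n} (hx : x ∈ S) : r x = fedosovR Γ x := by
  obtain ⟨-, hdeg, hinv, heq⟩ := h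
  have hr : r ∈ (hFiltration S hS).formLevel 1 (-3) :=
    mem_hFiltration_formLevel.2 fun x hx ν k α hd ↦ by
      by_contra hne
      have := hdeg x hx ν k α hne
      omega
  have hfix : ∀ x ∈ S, r x = rStep Γ r x := by
    intro x hx
    rw [← deltaInv_delta_one (hinv x hx), deltaInv_apply_congr (heq x hx), add_assoc, deltaInv_add]
    rfl
  refine eq_iterLimit (hS := hS) rIter_sub_succ_mem (m₀ := 3) (fixedPoint_sub_mem
    (M := (hFiltration S hS).formLevel 1 (-3)) (fun a ha b hb d ↦ rStep_sub_mem ha hb d)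
    (fun m _ ↦ rIter_mem_hFiltration m) (fun m hm ↦ rIter_succ hm) hr
    (fun d ↦ sub_mem_of_eqOn hfix d) ?_) hx
  rw [rIter_of_le le_rfl, ← sub_add_sub_cancel]
  exact AddSubgroup.add_mem _ (sub_mem_of_eqOn hfix _) (rStep_sub_deltaInv_mem hr)

include hS in
theorem IsFlatLiftOn.eq_hat {f : Phase n → ℂ} {a : WForm n 0} (h : IsFlatLiftOn S Γ f a)
    {x : Phase n} (hx : x ∈ S) : a x = hat Γ f x := by
  obtain ⟨-, hflat, hzero⟩ := h
  have hfix : ∀ x ∈ S, a x = hatStep Γ f a x := by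
    intro x hx
    have h1 : (nabla Γ a + iOverHComm (fedosovR Γ) a) x = delta a x := by
      have := hflat x hx
      rw [sub_add_eq_add_sub] at this
      exact sub_eq_zero.1 this
    funext ν
    ext k α
    have h2 := hzero x hx k
    rw [show ![] = ν from Subsingleton.elim _ _] at h2
    simp only [hatStep, Pi.add_apply, wcoeff_add]
    rw [deltaInv_apply_congr h1, deltaInv_delta_zero, scalarForm, wcoeff_wC]
    by_cases hα : α = 0
    · subst hα; simp [h2]
    · simp [hα]
  refine eq_iterLimit (hS := hS) (hatIter_sub_succ_mem f) (m₀ := 0) (fixedPoint_sub_mem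
    (M := Set.univ) (fun a _ b _ d ↦ hatStep_sub_mem d)
    (fun m _ ↦ Set.mem_univ _) (fun m _ ↦ hatIter_succ f m) (Set.mem_univ _)
    (fun d ↦ sub_mem_of_eqOn hfix d) ?_) hx
  rw [← sub_add_sub_cancel _ (hatStep Γ f a)]
  exact AddSubgroup.add_mem _ (sub_mem_of_eqOn hfix _) hatStep_sub_scalarForm_mem

end Fedosov


/-! ### Polynomials in the momenta -/

section MomentumPolynomials

variable {n : ℕ} {𝔸 : Type*} [NormedCommRing 𝔸] [NormedAlgebra ℝ 𝔸] {S : Set (Phase n)}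
  {F G : Phase n → 𝔸}

lemma phasePartial_eq_fderiv (hS : IsOpen S) (hF : ContDiffOn ℝ ∞ F S) (μ : Idx n)
    {x : Phase n} (hx : x ∈ S) : phasePartial μ F x = fderiv ℝ F x (Pi.single μ 1) :=
  ((hF.contDiffAt (hS.mem_nhds hx)).differentiableAt (by simp)).lineDeriv_eq_fderiv

lemma contDiffOn_phasePartial (hS : IsOpen S) (hF : ContDiffOn ℝ ∞ F S) (μ : Idx n) :
    ContDiffOn ℝ ∞ (phasePartial μ F) S :=
  ((hF.fderiv_of_isOpen hS (m := ∞) (by simp)).clm_apply contDiffOn_const).congr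
    fun _ hx ↦ phasePartial_eq_fderiv hS hF μ hx

lemma phasePartial_add (hS : IsOpen S) (hF : ContDiffOn ℝ ∞ F S) (hG : ContDiffOn ℝ ∞ G S)
    (μ : Idx n) {x : Phase n} (hx : x ∈ S) :
    phasePartial μ (F + G) x = phasePartial μ F x + phasePartial μ G x := by
  have dF := (hF.contDiffAt (hS.mem_nhds hx)).differentiableAt (by simp)
  have dG := (hG.contDiffAt (hS.mem_nhds hx)).differentiableAt (by simp)
  rw [phasePartial_eq_fderiv (F := F + G) hS (hF.add hG) μ hx, phasePartial_eq_fderiv hS hF μ hx,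
    phasePartial_eq_fderiv hS hG μ hx, fderiv_add dF dG]
  rfl

lemma phasePartial_mul (hS : IsOpen S) (hF : ContDiffOn ℝ ∞ F S) (hG : ContDiffOn ℝ ∞ G S)
    (μ : Idx n) {x : Phase n} (hx : x ∈ S) :
    phasePartial μ (F * G) x = (phasePartial μ F * G + F * phasePartial μ G) x := by
  have dF := (hF.contDiffAt (hS.mem_nhds hx)).differentiableAt (by simp)
  have dG := (hG.contDiffAt (hS.mem_nhds hx)).differentiableAt (by simp)
  rw [phasePartial_eq_fderiv (F := F * G) hS (hF.mul hG) μ hx, fderiv_mul dF dG]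
  simp only [Pi.add_apply, Pi.mul_apply, phasePartial_eq_fderiv hS hF μ hx,
    phasePartial_eq_fderiv hS hG μ hx, add_apply,
    smul_apply, smul_eq_mul]
  ring

lemma phasePartial_comm (hS : IsOpen S) (hF : ContDiffOn ℝ ∞ F S) (μ ν : Idx n)
    {x : Phase n} (hx : x ∈ S) :
    phasePartial μ (phasePartial ν F) x = phasePartial ν (phasePartial μ F) x := by
  have hFat := hF.contDiffAt (hS.mem_nhds hx)
  have hd : DifferentiableAt ℝ (fderiv ℝ F) x :=
    (hFat.fderiv_right (m := ∞) (by simp)).differentiableAt (by simp)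
  have key : ∀ μ ν, phasePartial μ (phasePartial ν F) x =
      fderiv ℝ (fderiv ℝ F) x (Pi.single μ 1) (Pi.single ν 1) := by
    intro μ ν
    rw [phasePartial_congr_of_isOpen hS (fun z hz ↦ phasePartial_eq_fderiv hS hF ν hz) μ hx]
    have h1 : HasFDerivAt (fun z ↦ fderiv ℝ F z (Pi.single ν 1))
        ((fderiv ℝ (fderiv ℝ F) x).flip (Pi.single ν 1)) x := by
      simpa using hd.hasFDerivAt.clm_apply (hasFDerivAt_const (Pi.single ν (1 : ℝ)) x)
    rw [phasePartial, h1.differentiableAt.lineDeriv_eq_fderiv, h1.fderiv]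
    rfl
  rw [key, key]
  have h2 : (2 : WithTop ℕ∞) ≤ ∞ := WithTop.coe_le_coe.2 (le_top : (2 : ℕ∞) ≤ ⊤)
  exact (hFat.isSymmSndFDerivAt (by simpa using h2)).eq _ _

/-- `MomPoly S e F` says that `F` is smooth over `S` and polynomial of degree `< e` in the
momenta, in the sense that all its momentum derivatives of order `e` vanish over `S`. Smoothness
is required at each stage, as `phasePartial` is zero where the derivative does not exist. -/
def MomPoly (S : Set (Phase n)) : ℕ → (Phase n → 𝔸) → Prop
  | 0, F => ∀ x ∈ S, F x = 0
  | e + 1, F => ContDiffOn ℝ ∞ F S ∧ ∀ i, MomPoly S e (phasePartial (.inr i) F)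

namespace MomPoly

lemma contDiffOn {e : ℕ} (h : MomPoly S e F) : ContDiffOn ℝ ∞ F S := by
  cases e with
  | zero => exact contDiffOn_const.congr h
  | succ e => exact h.1

lemma congr (hS : IsOpen S) {e : ℕ} (h : MomPoly S e F) (hFG : ∀ x ∈ S, G x = F x) :
    MomPoly S e G := by
  induction e generalizing F G with
  | zero => exact fun x hx ↦ (hFG x hx).trans (h x hx)
  | succ e ih =>
    exact ⟨h.1.congr hFG, fun i ↦ ih (h.2 i) fun x hx ↦ phasePartial_congr_of_isOpen hS hFG _ hx⟩

lemma succ (hS : IsOpen S) {e : ℕ} (h : MomPoly S e F) : MomPoly S (e + 1) F := by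
  induction e generalizing F with
  | zero =>
    refine ⟨h.contDiffOn, fun i x hx ↦ ?_⟩
    rw [phasePartial_congr_of_isOpen hS h _ hx]
    simp [phasePartial, lineDeriv]
  | succ e ih => exact ⟨h.1, fun i ↦ ih (h.2 i)⟩

lemma mono (hS : IsOpen S) {e e' : ℕ} (he : e ≤ e') (h : MomPoly S e F) : MomPoly S e' F := by
  induction e', he using Nat.le_induction with
  | base => exact h
  | succ e' _ ih => exact ih.succ hS

lemma add (hS : IsOpen S) {e : ℕ} (hF : MomPoly S e F) (hG : MomPoly S e G) :
    MomPoly S e (F + G) := by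
  induction e generalizing F G with
  | zero => exact fun x hx ↦ by simp [hF x hx, hG x hx]
  | succ e ih =>
    refine ⟨hF.1.add hG.1, fun i ↦ (ih (hF.2 i) (hG.2 i)).congr hS fun x hx ↦ ?_⟩
    exact phasePartial_add hS hF.1 hG.1 _ hx

/-- Leibniz' rule: degrees add under multiplication. -/
lemma mul (hS : IsOpen S) {e e' : ℕ} (hF : MomPoly S (e + 1) F) (hG : MomPoly S (e' + 1) G) :
    MomPoly S (e + e' + 1) (F * G) := by
  have aux : ∀ m e e' : ℕ, e + e' = m → ∀ F G : Phase n → 𝔸, MomPoly S (e + 1) F →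
      MomPoly S (e' + 1) G → MomPoly S (m + 1) (F * G) := by
    intro m
    induction m with
    | zero =>
      intro e e' hm F G hF hG
      obtain ⟨rfl, rfl⟩ : e = 0 ∧ e' = 0 := by omega
      refine ⟨hF.1.mul hG.1, fun i x hx ↦ ?_⟩
      rw [phasePartial_mul hS hF.1 hG.1 _ hx, Pi.add_apply, Pi.mul_apply, Pi.mul_apply,
        hF.2 i x hx, hG.2 i x hx]
      simp
    | succ m ih =>
      intro e e' hm F G hF hG
      refine ⟨hF.1.mul hG.1, fun i ↦ MomPoly.congr hS (add hS (F := phasePartial (.inr i) F * G)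
        (G := F * phasePartial (.inr i) G) ?_ ?_)
        fun x hx ↦ phasePartial_mul hS hF.1 hG.1 _ hx⟩
      · cases e with
        | zero => exact MomPoly.mono hS (Nat.zero_le _) fun x hx ↦ by simp [hF.2 i x hx]
        | succ e => exact ih e e' (by omega) _ _ (hF.2 i) hG
      · cases e' with
        | zero => exact MomPoly.mono hS (Nat.zero_le _) fun x hx ↦ by simp [hG.2 i x hx]
        | succ e' => exact ih e e' (by omega) _ _ hF (hG.2 i)
  exact aux _ e e' rfl F G hF hG

lemma phasePartial (hS : IsOpen S) {e : ℕ} (h : MomPoly S e F) (μ : Idx n) :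
    MomPoly S e (phasePartial μ F) := by
  induction e generalizing F with
  | zero =>
    intro x hx
    rw [phasePartial_congr_of_isOpen hS h _ hx]
    simp [FedosovCotangent.phasePartial, lineDeriv]
  | succ e ih =>
    exact ⟨contDiffOn_phasePartial hS h.1 μ, fun i ↦ (ih (h.2 i)).congr hS
      fun x hx ↦ phasePartial_comm hS h.1 _ _ hx⟩

lemma ofReal (hS : IsOpen S) {e : ℕ} {F : Phase n → ℝ} (h : MomPoly S e F) :
    MomPoly S e (fun x ↦ ((F x : ℝ) : ℂ)) := by
  induction e generalizing F with
  | zero => exact fun x hx ↦ by simp [h x hx]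
  | succ e ih =>
    refine ⟨Complex.ofRealCLM.contDiff.comp_contDiffOn h.1, fun i ↦ (ih (h.2 i)).congr hS
      fun x hx ↦ ?_⟩
    have hd := (h.1.contDiffAt (hS.mem_nhds hx)).differentiableAt (by simp)
    have := (Complex.ofRealCLM.hasFDerivAt.comp x hd.hasFDerivAt)
    rw [phasePartial_eq_fderiv hS h.1 _ hx, FedosovCotangent.phasePartial]
    exact this.differentiableAt.lineDeriv_eq_fderiv.trans (by rw [this.fderiv]; rfl)

end MomPoly

/-- `MomWeight S t F` says that over `S` the function `F` is smooth and polynomial in the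
momenta, and twice its degree is at most `t`; for `t < 0` this means that `F` vanishes. The index
of `MomPoly` is `⌊t/2⌋ + 1`, truncated at zero, as `MomPoly` is a strict bound. -/
def MomWeight (S : Set (Phase n)) (t : ℤ) (F : Phase n → 𝔸) : Prop :=
  MomPoly S ((t + 2) / 2).toNat F

namespace MomWeight

lemma eq_zero {t : ℤ} (h : MomWeight S t F) (ht : t < 0) : ∀ x ∈ S, F x = 0 := by
  have h0 : ((t + 2) / 2).toNat = 0 := by omega
  rw [MomWeight, h0] at h
  exact h

lemma of_eq_zero (hS : IsOpen S) (t : ℤ) (h : ∀ x ∈ S, F x = 0) : MomWeight S t F :=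
  MomPoly.mono (e := 0) hS (Nat.zero_le _) h

lemma mono (hS : IsOpen S) {s t : ℤ} (hst : s ≤ t) (h : MomWeight S s F) : MomWeight S t F :=
  MomPoly.mono hS (by omega) h

lemma add (hS : IsOpen S) {t : ℤ} (hF : MomWeight S t F) (hG : MomWeight S t G) :
    MomWeight S t (F + G) := MomPoly.add hS hF hG

lemma mul (hS : IsOpen S) {s t : ℤ} (hF : MomWeight S s F) (hG : MomWeight S t G) :
    MomWeight S (s + t) (F * G) := by
  rcases lt_or_ge s 0 with hs | hs
  · exact of_eq_zero hS _ fun x hx ↦ by simp [hF.eq_zero hs x hx]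
  rcases lt_or_ge t 0 with ht | ht
  · exact of_eq_zero hS _ fun x hx ↦ by simp [hG.eq_zero ht x hx]
  have h1 : ((s + 2) / 2).toNat = (s / 2).toNat + 1 := by omega
  have h2 : ((t + 2) / 2).toNat = (t / 2).toNat + 1 := by omega
  rw [MomWeight, h1] at hF
  rw [MomWeight, h2] at hG
  exact MomPoly.mono hS (by omega) (hF.mul hS hG)

lemma const (c : 𝔸) : MomWeight S 0 (fun _ ↦ c) :=
  ⟨contDiffOn_const, fun i x _ ↦ by simp [phasePartial, lineDeriv]⟩

lemma const_mul (hS : IsOpen S) (c : 𝔸) {t : ℤ} (h : MomWeight S t F) :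
    MomWeight S t (fun x ↦ c * F x) := by
  have := (const c).mul hS h
  rwa [zero_add] at this

lemma sum (hS : IsOpen S) {ι : Type*} {s : Finset ι} {t : ℤ} {F : ι → Phase n → 𝔸}
    (h : ∀ i ∈ s, MomWeight S t (F i)) : MomWeight S t (fun x ↦ ∑ i ∈ s, F i x) := by
  classical
  induction s using Finset.induction_on with
  | empty => exact of_eq_zero hS _ fun x _ ↦ by simp
  | insert a s ha ih =>
    simp only [Finset.sum_insert ha]
    exact (h a (Finset.mem_insert_self _ _)).add hS
      (ih fun i hi ↦ h i (Finset.mem_insert_of_mem hi))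

end MomWeight

/-- The contribution of an index to the `Q`-degree governs the effect of the corresponding
derivative: `∂/∂q` keeps the degree in the momenta, `∂/∂p` lowers it by one. -/
lemma MomWeight.phasePartial (hS : IsOpen S) {t : ℤ} (h : MomWeight S t F) (μ : Idx n) :
    MomWeight S (t + qSign μ - 1) (phasePartial μ F) := by
  rcases μ with i | i
  · refine MomPoly.mono hS ?_ (MomPoly.phasePartial hS h (.inl i))
    simp [qSign]
  · rcases lt_or_ge t 0 with ht | ht
    · refine MomPoly.mono hS (Nat.zero_le _) (e := 0) fun x hx ↦ ?_
      rw [phasePartial_congr_of_isOpen hS (h.eq_zero ht) _ hx]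
      simp [FedosovCotangent.phasePartial, lineDeriv]
    · have h1 : ((t + 2) / 2).toNat = ((t + qSign (.inr i : Idx n) - 1 + 2) / 2).toNat + 1 := by
        simp only [qSign]; omega
      rw [MomWeight, h1] at h
      exact h.2 i

end MomentumPolynomials

/-! ### The filtration by the `Q`-degree -/

section QFiltration

variable {n : ℕ} {S : Set (Phase n)}

/-- The filtration for which `formLevel c` consists of the forms whose component of `Q`-degree
`s` and `ħ`-degree `d/2` is polynomial of degree at most `(s - d + c)/2` in the momenta. -/
def qFiltration (S : Set (Phase n)) (hS : IsOpen S) : FormFiltration n where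
  level t :=
    { carrier := {f | MomWeight S t f}
      zero_mem' := MomWeight.of_eq_zero hS _ fun _ _ ↦ rfl
      add_mem' := fun hf hg ↦ MomWeight.add hS hf hg
      smul_mem' := fun c _ hf ↦ MomWeight.const_mul hS c hf }
  mono _ _ hst _ hf := MomWeight.mono hS hst hf
  one_mem := MomWeight.const 1
  mul_mem hf hg := MomWeight.mul hS hf hg
  weight μ := qSign μ - 1
  weightH := -2
  weight_pair _ := rfl
  formWeight := qSign
  gap := 1
  formWeight_eq _ := by ring
  derivDrop := 1
  deriv_mem {_ _} μ hf := MomWeight.phasePartial hS hf μ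

variable {hS : IsOpen S}

lemma qFiltration_deg {l : ℕ} (k : ℕ) (α : Idx n →₀ ℕ) (ν : Fin l → Idx n) :
    (qFiltration S hS).deg k α + ∑ j, (qFiltration S hS).formWeight (ν j) =
      qDegree α ν - twiceHDeg k α := by
  simp only [WeightedFiltration.deg, qFiltration, twiceHDeg, qDegree, Finsupp.degree_eq_sum,
    mul_sub, Finset.sum_sub_distrib, mul_one]
  push_cast
  ring

lemma qDegree_ge_of_mem {l : ℕ} {c : ℤ} {ξ : WForm n l}
    (hξ : ξ ∈ (qFiltration S hS).formLevel l c) {x : Phase n} (hx : x ∈ S) {ν : Fin l → Idx n}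
    {k : ℕ} {α : Idx n →₀ ℕ} (h : wcoeff k α (ξ x ν) ≠ 0) :
    (twiceHDeg k α : ℤ) - c ≤ qDegree α ν := by
  by_contra hlt
  have h1 := qFiltration_deg (hS := hS) k α ν
  refine h (MomWeight.eq_zero (hξ ν k α) ?_ x hx)
  omega

/-- Lowering an index with `ω` turns a `q`-index into a `p`-index and conversely, and so reverses
its sign. -/
lemma symp_mul_momWeight (hS : IsOpen S) {F : Idx n → Phase n → ℝ} (α : Idx n)
    {s : ℤ} (h : ∀ l, qSign α + qSign l = 0 → MomWeight S s (F l)) :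
    MomWeight S s (fun x ↦ ∑ l, symp n α l * F l x) := by
  refine MomWeight.sum hS fun l _ ↦ ?_
  by_cases hl : symp n α l = 0
  · exact MomWeight.of_eq_zero hS _ fun x _ ↦ by simp [hl]
  · refine MomWeight.const_mul hS _ (h l ?_)
    obtain ⟨i, ⟨rfl, rfl⟩ | ⟨rfl, rfl⟩⟩ := symp_ne_zero hl <;> rfl

/-- The weights of the connection coefficients `Γ^κ_{μν}` for which the connection has
`Q`-degree at least one. -/
def IsMomAdapted (S : Set (Phase n)) (Γ : Phase n → Idx n → Idx n → Idx n → ℝ) : Prop :=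
  ∀ κ μ ν, MomWeight S (-qSign κ + qSign μ + qSign ν - 1) (fun x ↦ Γ x κ μ ν)

variable {Γ : Phase n → Idx n → Idx n → Idx n → ℝ}

lemma IsMomAdapted.lowered (hΓ : IsMomAdapted S Γ) (hS : IsOpen S) (α β γ : Idx n) :
    MomWeight S (qSign α + qSign β + qSign γ - 1) (fun x ↦ loweredChristoffel Γ x α β γ) :=
  symp_mul_momWeight hS α fun l hl ↦ MomWeight.mono hS (by omega) (hΓ l β γ)

lemma IsMomAdapted.curvature (hΓ : IsMomAdapted S Γ) (hS : IsOpen S) (i j k l : Idx n) :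
    MomWeight S (-qSign i + qSign j + qSign k + qSign l - 2) (fun x ↦ curvature Γ x i j k l) := by
  have hd : ∀ k l, MomWeight S (-qSign i + qSign j + qSign k + qSign l - 2)
      (phasePartial k fun z ↦ Γ z i l j) := fun k l ↦
    MomWeight.mono hS (by omega) ((hΓ i l j).phasePartial hS k)
  have hp : ∀ k l, MomWeight S (-qSign i + qSign j + qSign k + qSign l - 2)
      (fun x ↦ ∑ m, Γ x i k m * Γ x m l j) := fun k l ↦
    MomWeight.sum hS fun m _ ↦ MomWeight.mono hS (by omega) ((hΓ i k m).mul hS (hΓ m l j))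
  have hneg : ∀ {t : ℤ} {F : Phase n → ℝ}, MomWeight S t F → MomWeight S t (fun x ↦ -1 * F x) :=
    fun h ↦ MomWeight.const_mul hS _ h
  have := (((hd k l).add hS (MomWeight.mono hS (by omega) (hneg (hd l k)))).add hS (hp k l)).add hS
    (MomWeight.mono hS (by omega) (hneg (hp l k)))
  convert this using 1
  funext x
  simp only [FedosovCotangent.curvature, Pi.add_apply]
  ring

lemma IsMomAdapted.isAdapted (hΓ : IsMomAdapted S Γ) (hS : IsOpen S) :
    (qFiltration S hS).IsAdapted Γ := by
  intro μ
  refine WeightedFiltration.metaplectic_mem fun α β ↦ ?_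
  refine MomWeight.mono hS (le_of_eq ?_) ((hΓ.lowered hS α β μ).ofReal hS)
  simp only [qFiltration]; ring

lemma IsMomAdapted.curvatureForm_mem (hΓ : IsMomAdapted S Γ) (hS : IsOpen S) :
    curvatureForm Γ ∈ (qFiltration S hS).formLevel 2 0 := by
  intro ν
  refine WeightedFiltration.metaplectic_mem fun α β ↦ ?_
  have h : MomWeight S (qSign α + qSign β + qSign (ν 0) + qSign (ν 1) - 2)
      (fun x ↦ loweredCurvature Γ x α β (ν 0) (ν 1)) :=
    symp_mul_momWeight hS α fun l hl ↦
      MomWeight.mono hS (by omega) (hΓ.curvature hS l β (ν 0) (ν 1))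
  refine MomWeight.mono hS (le_of_eq ?_) (h.ofReal hS)
  rw [Fin.sum_univ_two]
  simp only [qFiltration]; ring

/-- A component of `r` of `ħ`-degree `d/2` and `Q`-degree `s` is polynomial of degree at most
`(s - d + 1)/2` in the momenta. -/
lemma IsMomAdapted.rIter_mem (hΓ : IsMomAdapted S Γ) (hS : IsOpen S) (k : ℕ) :
    rIter Γ k ∈ (qFiltration S hS).formLevel 1 1 :=
  FedosovCotangent.rIter_mem (hΓ.isAdapted hS)
    (FormFiltration.formLevel_mono (by simp [qFiltration])
      (FormFiltration.deltaInv_mem (hΓ.curvatureForm_mem hS)))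
    (by simp [qFiltration]) (by simp [qFiltration]) k

lemma IsMomAdapted.fedosovR_mem (hΓ : IsMomAdapted S Γ) (hS : IsOpen S) :
    fedosovR Γ ∈ (qFiltration S hS).formLevel 1 1 :=
  iterLimit_mem (hΓ.rIter_mem hS)

/-- A component of `f̂` of `ħ`-degree `d/2` and `Q`-degree `s` is polynomial of degree at most
`(s - d)/2 + N` in the momenta. -/
lemma IsMomAdapted.hatIter_mem (hΓ : IsMomAdapted S Γ) (hS : IsOpen S) {N : ℕ}
    {f : Phase n → ℂ} (hf : MomPoly S (N + 1) f) (k : ℕ) :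
    hatIter Γ f k ∈ (qFiltration S hS).formLevel 0 (2 * N) :=
  FedosovCotangent.hatIter_mem (hΓ.isAdapted hS) (MomPoly.mono hS (by omega) hf)
    (hΓ.fedosovR_mem hS) (by simp [qFiltration]) (by simp [qFiltration]) k

end QFiltration


/-! ### The lifted connection -/

section LiftedConnection

variable {n : ℕ} {U : Set (Model n)}

lemma contDiff_position : ContDiff ℝ ∞ (position : Phase n → Model n) :=
  contDiff_euclidean.2 fun i ↦ contDiff_apply ℝ ℝ (Sum.inl i)

lemma isOpen_position_preimage (hU : IsOpen U) : IsOpen {x : Phase n | position x ∈ U} :=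
  hU.preimage contDiff_position.continuous

lemma position_add_smul_single_inr (x : Phase n) (t : ℝ) (i : Fin n) :
    position (x + t • Pi.single (.inr i) (1 : ℝ)) = position x := by
  ext j; simp [position]

lemma momWeight_comp_position {h : Model n → ℝ} (hh : ContDiffOn ℝ ∞ h U) :
    MomWeight {x : Phase n | position x ∈ U} 0 (fun x ↦ h (position x)) := by
  refine ⟨hh.comp contDiff_position.contDiffOn fun _ hx ↦ hx, fun i x _ ↦ ?_⟩
  simp [phasePartial, lineDeriv, position_add_smul_single_inr]

lemma momWeight_momentum (S : Set (Phase n)) (a : Fin n) :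
    MomWeight S 2 (fun x : Phase n ↦ x (.inr a)) := by
  have hd : ∀ i : Fin n, phasePartial (.inr i) (fun x : Phase n ↦ x (.inr a)) =
      fun _ ↦ (Pi.single (.inr i) 1 : Phase n) (.inr a) := by
    intro i
    funext x
    have h := hasFDerivAt_apply (𝕜 := ℝ) (Sum.inr a : Idx n) x
    rw [phasePartial, h.differentiableAt.lineDeriv_eq_fderiv, h.fderiv]
    rfl
  refine ⟨(contDiff_apply ℝ ℝ (Sum.inr a)).contDiffOn, fun i ↦ ?_⟩
  rw [hd]
  exact MomWeight.const (S := S) _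

lemma contDiffOn_basePartial (hU : IsOpen U) {h : Model n → ℝ} (hh : ContDiffOn ℝ ∞ h U)
    (i : Fin n) : ContDiffOn ℝ ∞ (basePartial i h) U :=
  ((hh.fderiv_of_isOpen hU (m := ∞) (by simp)).clm_apply contDiffOn_const).congr
    fun _ hx ↦ ((hh.contDiffAt (hU.mem_nhds hx)).differentiableAt (by simp)).lineDeriv_eq_fderiv

lemma contDiffOn_det {E : Type*} [NormedAddCommGroup E] [NormedSpace ℝ E] {U : Set E}
    {G : E → Matrix (Fin n) (Fin n) ℝ}
    (hG : ∀ i j, ContDiffOn ℝ ∞ (fun u ↦ G u i j) U) : ContDiffOn ℝ ∞ (fun u ↦ (G u).det) U := by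
  simp only [Matrix.det_apply']
  exact ContDiffOn.sum fun σ _ ↦ contDiffOn_const.mul (contDiffOn_prod fun i _ ↦ hG _ _)

lemma contDiffOn_inv_apply {E : Type*} [NormedAddCommGroup E] [NormedSpace ℝ E] {U : Set E}
    {G : E → Matrix (Fin n) (Fin n) ℝ}
    (hG : ∀ i j, ContDiffOn ℝ ∞ (fun u ↦ G u i j) U) (hdet : ∀ u ∈ U, (G u).det ≠ 0)
    (k l : Fin n) : ContDiffOn ℝ ∞ (fun u ↦ (G u)⁻¹ k l) U := by
  simp only [Matrix.inv_def, Ring.inverse_eq_inv', Matrix.smul_apply, smul_eq_mul,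
    Matrix.adjugate_apply]
  refine ((contDiffOn_det hG).inv hdet).mul (contDiffOn_det fun i j ↦ ?_)
  by_cases h : i = l
  · subst h; simpa using contDiffOn_const
  · simpa [Matrix.updateRow_ne h] using hG i j

variable {G : Model n → Matrix (Fin n) (Fin n) ℝ}

lemma contDiffOn_baseChristoffel (hU : IsOpen U) (hG : ∀ i j, ContDiffOn ℝ ∞ (fun u ↦ G u i j) U)
    (hdet : ∀ u ∈ U, (G u).det ≠ 0) (k i j : Fin n) :
    ContDiffOn ℝ ∞ (fun u ↦ baseChristoffel G u k i j) U :=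
  contDiffOn_const.mul (ContDiffOn.sum fun l _ ↦ (contDiffOn_inv_apply hG hdet k l).mul
    (((contDiffOn_basePartial hU (hG j l) i).add (contDiffOn_basePartial hU (hG i l) j)).sub
      (contDiffOn_basePartial hU (hG i j) l)))

lemma contDiffOn_liftTerm (hU : IsOpen U) (hG : ∀ i j, ContDiffOn ℝ ∞ (fun u ↦ G u i j) U)
    (hdet : ∀ u ∈ U, (G u).det ≠ 0) (a i j k : Fin n) :
    ContDiffOn ℝ ∞ (fun u ↦ liftTerm G u a i j k) U :=
  (contDiffOn_const.mul (ContDiffOn.sum fun l _ ↦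
    (contDiffOn_baseChristoffel hU hG hdet a j l).mul
      (contDiffOn_baseChristoffel hU hG hdet l k i))).sub
    (contDiffOn_basePartial hU (contDiffOn_baseChristoffel hU hG hdet a k i) j)

/-- The coefficients of the lifted connection do not depend on the momenta, except those with
three `q`-indices after lowering, which are linear in them. -/
lemma isMomAdapted_liftedChristoffel (hU : IsOpen U)
    (hG : ∀ i j, ContDiffOn ℝ ∞ (fun u ↦ G u i j) U) (hdet : ∀ u ∈ U, (G u).det ≠ 0) :
    IsMomAdapted {x | position x ∈ U} (liftedChristoffel G) := by
  have hS := isOpen_position_preimage hU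
  have hΓ : ∀ k i j, MomWeight {x : Phase n | position x ∈ U} 0
      (fun x ↦ baseChristoffel G (position x) k i j) := fun k i j ↦
    momWeight_comp_position (contDiffOn_baseChristoffel hU hG hdet k i j)
  have hneg : ∀ k i j, MomWeight {x : Phase n | position x ∈ U} 0
      (fun x ↦ -baseChristoffel G (position x) k i j) := fun k i j ↦
    momWeight_comp_position (contDiffOn_baseChristoffel hU hG hdet k i j).neg
  have hzero : ∀ t, MomWeight {x : Phase n | position x ∈ U} t (fun _ ↦ (0 : ℝ)) := fun t ↦
    MomWeight.of_eq_zero hS t fun _ _ ↦ rfl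
  intro κ μ ν
  rcases κ with k | k <;> rcases μ with i | i <;> rcases ν with j | j
  · exact hΓ k i j
  · exact hzero _
  · exact hzero _
  · exact hzero _
  · refine MomWeight.sum hS fun a _ ↦ ?_
    have h1 := MomWeight.const_mul hS (1 / 3 : ℝ)
      (momWeight_momentum {x : Phase n | position x ∈ U} a)
    have h2 := h1.mul hS (momWeight_comp_position (((contDiffOn_liftTerm hU hG hdet a i j k).add
      (contDiffOn_liftTerm hU hG hdet a j k i)).add (contDiffOn_liftTerm hU hG hdet a k i j)))
    refine MomPoly.congr hS (MomWeight.mono hS (by simp [qSign]) h2) fun x _ ↦ ?_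
    simp only [Pi.mul_apply]
    ring
  · exact hneg j i k
  · exact hneg i k j
  · exact hzero _

end LiftedConnection

/-! ### Functions on phase space that are polynomial on the fibres -/

section FibrewisePolynomials

variable {n : ℕ}

lemma hasDerivAt_eval_momenta (P : MvPolynomial (Fin n) ℂ) (x : Phase n) (i : Fin n) :
    HasDerivAt (fun t : ℝ ↦ MvPolynomial.eval
        (fun j ↦ (((x + t • Pi.single (Sum.inr i) (1 : ℝ) : Phase n) (.inr j) : ℝ) : ℂ)) P)
      (MvPolynomial.eval (fun j ↦ ((x (.inr j) : ℝ) : ℂ)) (MvPolynomial.pderiv i P)) 0 := by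
  induction P using MvPolynomial.induction_on with
  | C a => simpa using hasDerivAt_const (0 : ℝ) a
  | add P Q hP hQ =>
    simp only [map_add]
    exact hP.add hQ
  | mul_X P j hP =>
    have hX : HasDerivAt
        (fun t : ℝ ↦ (((x + t • Pi.single (Sum.inr i) (1 : ℝ) : Phase n) (.inr j) : ℝ) : ℂ))
        (if j = i then 1 else 0) 0 := by
      by_cases h : j = i
      · subst h
        simpa using ((hasDerivAt_id (0 : ℝ)).ofReal_comp).const_add ((x (.inr j) : ℝ) : ℂ)
      · simpa [h] using hasDerivAt_const (0 : ℝ) ((x (.inr j) : ℝ) : ℂ)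
    simp only [map_mul, MvPolynomial.eval_X]
    refine (hP.mul hX).congr_deriv ?_
    by_cases h : j = i
    · subst h
      simp only [zero_smul, add_zero, if_true, mul_one, Derivation.leibniz,
        MvPolynomial.pderiv_X_self, smul_eq_mul, map_add, map_mul, MvPolynomial.eval_X]
      ring
    · simp only [zero_smul, add_zero, if_neg h, mul_zero, Derivation.leibniz,
        MvPolynomial.pderiv_X_of_ne h, smul_eq_mul, zero_add, map_mul, MvPolynomial.eval_X]
      ring

lemma totalDegree_pderiv_le {N : ℕ} {P : MvPolynomial (Fin n) ℂ} (hP : P.totalDegree ≤ N + 1)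
    (i : Fin n) : (MvPolynomial.pderiv i P).totalDegree ≤ N := by
  refine Finset.sup_le fun m hm ↦ ?_
  rw [MvPolynomial.mem_support_iff, MvPolynomial.coeff_pderiv] at hm
  have := (MvPolynomial.le_totalDegree
    (MvPolynomial.mem_support_iff.2 (left_ne_zero_of_mul hm))).trans hP
  rw [Finsupp.sum_add_index' (fun _ ↦ rfl) (fun _ _ _ ↦ rfl), Finsupp.sum_single_index rfl] at this
  omega

/-- A smooth function that is polynomial on each fibre has vanishing momentum derivatives of high
order; the coefficients need not be identified as functions of the base point. -/
lemma momPoly_of_fibrewise {S : Set (Phase n)} {N : ℕ} {F : Phase n → ℂ} (hS : IsOpen S)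
    (hF : ContDiffOn ℝ ∞ F S)
    (hP : ∀ x ∈ S, ∃ P : MvPolynomial (Fin n) ℂ, P.totalDegree ≤ N ∧
      ∀ z, position z = position x → F z = MvPolynomial.eval (fun i ↦ ((z (.inr i) : ℝ) : ℂ)) P) :
    MomPoly S (N + 1) F := by
  have key : ∀ {F : Phase n → ℂ} {x : Phase n} {P : MvPolynomial (Fin n) ℂ},
      (∀ z, position z = position x →
        F z = MvPolynomial.eval (fun i ↦ ((z (.inr i) : ℝ) : ℂ)) P) →
      ∀ i z, position z = position x → phasePartial (.inr i) F z =
        MvPolynomial.eval (fun i ↦ ((z (.inr i) : ℝ) : ℂ)) (MvPolynomial.pderiv i P) := by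
    intro F x P h i z hz
    have h1 : (fun t : ℝ ↦ F (z + t • Pi.single (Sum.inr i : Idx n) (1 : ℝ))) = fun t : ℝ ↦
        MvPolynomial.eval
          (fun j ↦ (((z + t • Pi.single (Sum.inr i) (1 : ℝ) : Phase n) (.inr j) : ℝ) : ℂ)) P :=
      funext fun t ↦ h _ ((position_add_smul_single_inr z t i).trans hz)
    rw [phasePartial, lineDeriv, h1]
    exact (hasDerivAt_eval_momenta P z i).deriv
  induction N generalizing F with
  | zero =>
    refine ⟨hF, fun i x hx ↦ ?_⟩
    obtain ⟨P, hdeg, hP⟩ := hP x hx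
    rw [key hP i x rfl, MvPolynomial.totalDegree_eq_zero_iff_eq_C.1 (Nat.le_zero.1 hdeg)]
    simp
  | succ N ih =>
    refine ⟨hF, fun i ↦ ih (contDiffOn_phasePartial hS hF _) fun x hx ↦ ?_⟩
    obtain ⟨P, hdeg, hP⟩ := hP x hx
    exact ⟨MvPolynomial.pderiv i P, totalDegree_pderiv_le hdeg i, key hP i⟩

end FibrewisePolynomials


/-! ### The metric and the cotangent bundle in a chart -/

section Charts

variable {n : ℕ} {Q : Type*} [TopologicalSpace Q] [ChartedSpace (Model n) Q]
  [IsManifold (𝓡 n) ∞ Q] {φ : OpenPartialHomeomorph Q (Model n)}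

omit [IsManifold (𝓡 n) ∞ Q] in
lemma mdifferentiable_of_mem_maximalAtlas (hφ : φ ∈ IsManifold.maximalAtlas (𝓡 n) ∞ Q) :
    φ.MDifferentiable (𝓡 n) (𝓡 n) :=
  ⟨(contMDiffOn_of_mem_maximalAtlas hφ).mdifferentiableOn (by simp),
    (contMDiffOn_symm_of_mem_maximalAtlas hφ).mdifferentiableOn (by simp)⟩

/-- The coordinate vector fields are smooth. -/
lemma contMDiffOn_mfderiv_symm (hφ : φ ∈ IsManifold.maximalAtlas (𝓡 n) ∞ Q) (v : Model n) :
    ContMDiffOn (𝓡 n) (𝓡 n).tangent ∞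
      (fun u ↦ (⟨φ.symm u, mfderiv (𝓡 n) (𝓡 n) φ.symm u v⟩ : TangentBundle (𝓡 n) Q))
      φ.target := by
  have hM : IsManifold (𝓡 n) 1 Q := IsManifold.of_le (n := ∞) (by simp)
  have h1 := (contMDiffOn_symm_of_mem_maximalAtlas hφ).contMDiffOn_tangentMapWithin (m := ∞)
    (by simp) φ.open_target.uniqueMDiffOn
  have h2 : ContMDiffOn (𝓡 n) (𝓡 n).tangent ∞
      (fun u ↦ (⟨u, v⟩ : TangentBundle (𝓡 n) (Model n))) φ.target :=
    contMDiffOn_vectorSpace_iff_contDiffOn.2 contDiffOn_const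
  refine (h1.comp h2 fun u hu ↦ hu).congr fun u hu ↦ ?_
  simp only [Function.comp_apply, tangentMapWithin]
  rw [mfderivWithin_of_isOpen φ.open_target hu]

lemma SemiRiemannianMetric.contDiffOn_coeffs (g : SemiRiemannianMetric n Q)
    (hφ : φ ∈ IsManifold.maximalAtlas (𝓡 n) ∞ Q) (i j : Fin n) :
    ContDiffOn ℝ ∞ (fun u ↦ g.coeffs φ u i j) φ.target := by
  rw [← contMDiffOn_iff_contDiffOn]
  have hM : IsManifold (𝓡 n) 1 Q := IsManifold.of_le (n := ∞) (by simp)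
  have : ContMDiffOn (𝓡 n) ((𝓡 n).prod 𝓘(ℝ)) ∞
      (fun u ↦ Bundle.TotalSpace.mk' ℝ (E := Bundle.Trivial Q ℝ) (φ.symm u)
        (g.val (φ.symm u) (mfderiv (𝓡 n) (𝓡 n) φ.symm u (EuclideanSpace.single i (1 : ℝ)))
          (mfderiv (𝓡 n) (𝓡 n) φ.symm u (EuclideanSpace.single j (1 : ℝ))))) φ.target := by
    apply ContMDiffOn.clm_bundle_apply₂ (F₁ := Model n) (F₂ := Model n)
      (E₁ := (TangentSpace (𝓡 n) : Q → Type _)) (E₂ := (TangentSpace (𝓡 n) : Q → Type _))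
    · exact g.contMDiff.comp_contMDiffOn (contMDiffOn_symm_of_mem_maximalAtlas hφ)
    · exact contMDiffOn_mfderiv_symm hφ _
    · exact contMDiffOn_mfderiv_symm hφ _
  intro u hu
  have := this u hu
  simp only [Bundle.contMDiffWithinAt_totalSpace] at this
  exact this.2

/-- Nondegeneracy of the metric in coordinates, the coordinate vector fields being a frame. -/
lemma SemiRiemannianMetric.det_coeffs_ne_zero (g : SemiRiemannianMetric n Q)
    (hφ : φ ∈ IsManifold.maximalAtlas (𝓡 n) ∞ Q) {u : Model n} (hu : u ∈ φ.target) :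
    (g.coeffs φ u).det ≠ 0 := by
  intro hdet
  obtain ⟨v, hv, hv0⟩ := Matrix.exists_mulVec_eq_zero_iff.2 hdet
  have he := (mdifferentiable_of_mem_maximalAtlas hφ).symm
  let D : Model n →L[ℝ] TangentSpace (𝓡 n) (φ.symm u) := mfderiv (𝓡 n) (𝓡 n) φ.symm u
  have hbij : Function.Bijective D := he.mfderiv_bijective hu
  have hdec : ∀ w : Model n, w = ∑ j, w j • EuclideanSpace.single j (1 : ℝ) := by
    intro w
    ext k
    simp [Finset.sum_apply, Pi.single_apply]
  have h1 : ∀ i, g.val (φ.symm u) (D (EuclideanSpace.single i (1 : ℝ)))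
      (D (WithLp.toLp 2 v)) = 0 := by
    intro i
    have := congrFun hv0 i
    rw [hdec (WithLp.toLp 2 v), map_sum, map_sum]
    simp only [map_smul, smul_eq_mul]
    rw [← Pi.zero_apply (M := fun _ : Fin n ↦ ℝ) i, ← this]
    simp only [Matrix.mulVec, dotProduct, SemiRiemannianMetric.coeffs, Matrix.of_apply]
    exact Finset.sum_congr rfl fun j _ ↦ mul_comm _ _
  have h2 : D (WithLp.toLp 2 v) = 0 := by
    refine g.nondegenerate _ _ fun w ↦ ?_
    obtain ⟨w, rfl⟩ := hbij.2 w
    rw [g.symm, hdec w, map_sum, map_sum, sum_apply]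
    exact Finset.sum_eq_zero fun i _ ↦ by rw [map_smul, map_smul, smul_apply, h1, smul_zero]
  refine hv ?_
  have h3 := hbij.1 (h2.trans (map_zero D).symm)
  simpa using congrArg WithLp.ofLp h3

/-- The canonical coordinates are a smooth parametrization of the cotangent bundle. -/
lemma contMDiffOn_canonicalPoint (hφ : φ ∈ IsManifold.maximalAtlas (𝓡 n) ∞ Q) :
    ContMDiffOn 𝓘(ℝ, Phase n) ((𝓡 n).prod 𝓘(ℝ, Model n →L[ℝ] ℝ)) ∞
      (canonicalPoint φ) (canonicalDomain φ) := by
  have hM : IsManifold (𝓡 n) 1 Q := IsManifold.of_le (n := ∞) (by simp)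
  intro x₀ hx₀
  refine ContMDiffAt.contMDiffWithinAt ?_
  have hpos : ContMDiffAt 𝓘(ℝ, Phase n) (𝓡 n) ∞ (fun x : Phase n ↦ φ.symm (position x)) x₀ :=
    (contMDiffAt_symm_of_mem_maximalAtlas hφ hx₀).comp x₀
      contDiff_position.contDiffAt.contMDiffAt
  have hD : ContMDiffAt (𝓡 n) 𝓘(ℝ, Model n →L[ℝ] Model n) ∞
      (inTangentCoordinates (𝓡 n) (𝓡 n) id φ (mfderiv (𝓡 n) (𝓡 n) φ) (φ.symm (position x₀)))
      (φ.symm (position x₀)) :=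
    (contMDiffAt_of_mem_maximalAtlas hφ (φ.map_target hx₀)).mfderiv_const (by simp)
  have hD' := hD.comp x₀ hpos
  refine (contMDiffAt_hom_bundle _).2 ⟨hpos, ?_⟩
  -- Read in the trivialization at `x₀`, the covector `∑ pᵢ dφⁱ` is a combination of the rows of
  -- the derivative of `φ`, which is smooth in these tangent coordinates.
  have hsum : ContMDiffAt 𝓘(ℝ, Phase n) 𝓘(ℝ, Model n →L[ℝ] ℝ) ∞
      (fun x : Phase n ↦ ∑ i : Fin n, x (Sum.inr i) •
        (EuclideanSpace.proj i : Model n →L[ℝ] ℝ).comp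
          (inTangentCoordinates (𝓡 n) (𝓡 n) id φ (mfderiv (𝓡 n) (𝓡 n) φ) (φ.symm (position x₀))
            (φ.symm (position x)))) x₀ := by
    rw [contMDiffAt_iff_contDiffAt] at hD' ⊢
    refine ContDiffAt.sum fun i _ ↦ ContDiffAt.smul (contDiff_apply ℝ ℝ _).contDiffAt ?_
    exact contDiffAt_const.clm_comp hD'
  refine hsum.congr_of_eventuallyEq (Filter.Eventually.of_forall fun x ↦ ?_)
  ext v
  simp only [canonicalPoint, inTangentCoordinates, ContinuousLinearMap.inCoordinates, id,
    TangentBundle.continuousLinearMapAt_model_space]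
  simp
  rfl

/-- In canonical coordinates, the fibre coordinates are those with respect to the coordinate
vector fields. -/
lemma IsMomentumPolynomial.exists_eval {N : ℕ} {f : CotangentBundle n Q → ℂ}
    (hf : IsMomentumPolynomial N f) (hφ : φ ∈ IsManifold.maximalAtlas (𝓡 n) ∞ Q) {x : Phase n}
    (hx : x ∈ canonicalDomain φ) :
    ∃ P : MvPolynomial (Fin n) ℂ, P.totalDegree ≤ N ∧ ∀ z, position z = position x →
      f (canonicalPoint φ z) = MvPolynomial.eval (fun i ↦ ((z (.inr i) : ℝ) : ℂ)) P := by
  let e := (mdifferentiable_of_mem_maximalAtlas hφ).mfderiv (φ.map_target hx)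
  let b : Module.Basis (Fin n) ℝ (TangentSpace (𝓡 n) (φ.symm (position x))) :=
    (EuclideanSpace.basisFun (Fin n) ℝ).toBasis.map e.symm.toLinearEquiv
  obtain ⟨P, hdeg, hP⟩ := hf _ b
  refine ⟨P, hdeg, fun z hz ↦ ?_⟩
  have hb : ∀ j, mfderiv (𝓡 n) (𝓡 n) φ (φ.symm (position x)) (b j) =
      EuclideanSpace.single j (1 : ℝ) := by
    intro j
    have h1 : b j = e.symm (EuclideanSpace.single j (1 : ℝ)) := by
      rw [← EuclideanSpace.basisFun_apply, ← OrthonormalBasis.coe_toBasis]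
      exact Module.Basis.map_apply ..
    rw [h1]
    exact e.apply_symm_apply _
  rw [canonicalPoint, hz, hP]
  congr 2
  funext j
  congr 1
  have hc : ∀ i, ((EuclideanSpace.proj i : Model n →L[ℝ] ℝ).comp
      (mfderiv (𝓡 n) (𝓡 n) φ (φ.symm (position x)))) (b j) =
      (EuclideanSpace.single j (1 : ℝ) : Model n) i :=
    fun i ↦ congrArg (fun w : Model n ↦ w i) (hb j)
  rw [sum_apply]
  simp only [smul_apply, hc]
  simp

end Charts


/-! ### Bounds for the `Q`-degree -/

section Bounds

variable {n l : ℕ} {S : Set (Phase n)} {hS : IsOpen S}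

/-- The two filtrations together bound the `Q`-degree from below. -/
lemma le_qDegree {c d : ℤ} {ξ : WForm n l} (hq : ξ ∈ (qFiltration S hS).formLevel l c)
    (hh : ξ ∈ (hFiltration S hS).formLevel l (-d)) {x : Phase n} (hx : x ∈ S)
    {ν : Fin l → Idx n} {k : ℕ} {α : Idx n →₀ ℕ} (h : wcoeff k α (ξ x ν) ≠ 0) :
    d - c ≤ qDegree α ν := by
  have h1 := qDegree_ge_of_mem hq hx h
  have h2 : d ≤ twiceHDeg k α := by
    by_contra hlt
    exact h (mem_hFiltration_formLevel.1 hh x hx ν k α (by omega))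
  omega

lemma exists_wcoeff_ne_zero {a : Weyl n} {k : ℤ} {α : Idx n →₀ ℕ}
    (h : MvPowerSeries.coeff α
      ((HahnSeries.ofPowerSeries ℤ (MvPowerSeries (Idx n) ℂ) a).coeff k) ≠ 0) :
    ∃ m, wcoeff m α a ≠ 0 := by
  -- Coefficients at negative exponents vanish, the others are those of the power series.
  refine ⟨k.natAbs, fun h0 ↦ h ?_⟩
  rw [PowerSeries.coeff_coe]
  split_ifs
  · exact map_zero _
  · exact h0

lemma qDegGT_toLaurent {c d m : ℤ} {ξ : WForm n l} (hq : ξ ∈ (qFiltration S hS).formLevel l c)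
    (hh : ξ ∈ (hFiltration S hS).formLevel l (-d)) (hm : m < d - c) :
    QDegGT S ξ.toLaurent m := by
  intro x hx ν k α h
  obtain ⟨k', hk'⟩ := exists_wcoeff_ne_zero h
  exact hm.trans_le (le_qDegree hq hh hx hk')

lemma qDegGT_iOverHLaurent_mul {c d m : ℤ} {ξ : WForm n l}
    (hq : ξ ∈ (qFiltration S hS).formLevel l c)
    (hh : ξ ∈ (hFiltration S hS).formLevel l (-d)) (hm : m < d - c) :
    QDegGT S (fun x ν ↦ iOverHLaurent n * ξ.toLaurent x ν) m := by
  intro x hx ν k α h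
  rw [iOverHLaurent, HahnSeries.coeff_single_mul, MvPowerSeries.coeff_C_mul] at h
  obtain ⟨k', hk'⟩ := exists_wcoeff_ne_zero (right_ne_zero_of_mul h)
  exact hm.trans_le (le_qDegree hq hh hx hk')

lemma QDegGT.qDegGE {η : LWForm n l} {m : ℤ} (h : QDegGT S η (m - 1)) : QDegGE S η m :=
  fun x hx ν k α hne ↦ by have := h x hx ν k α hne; omega

lemma flatGamma_mem {P : FormFiltration n}
    (hP : ∀ i, P.formWeight (.inl i) + P.formWeight (.inr i) = 0) :
    flatGamma n ∈ P.formLevel 1 P.gap := by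
  intro ν
  refine WeightedFiltration.sum_mem fun β _ ↦ ?_
  by_cases h : symp n (ν 0) β = 0
  · simp only [h, Complex.ofReal_zero, wC, map_zero, zero_mul]
    exact AddSubgroup.zero_mem _
  · refine WeightedFiltration.wC_mul_mem _
      (WeightedFiltration.weylLevel_mono (le_of_eq ?_) (WeightedFiltration.gen_mem β))
    have h1 : P.formWeight (ν 0) + P.formWeight β = 0 := by
      obtain ⟨i, ⟨h1, h2⟩ | ⟨h1, h2⟩⟩ := symp_ne_zero h
      · rw [h1, h2, hP]
      · rw [h1, h2, add_comm, hP]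
    have h2 := P.formWeight_eq β
    simp only [Fin.sum_univ_one]
    omega

/-- The 1-form `(ħ/i) dU(Γ)`. -/
def metaplecticForm (Γ : Phase n → Idx n → Idx n → Idx n → ℝ) : WForm n 1 :=
  fun x ν ↦ metaplectic fun α β ↦ loweredChristoffel Γ x α β (ν 0)

lemma metaplecticForm_mem {P : FormFiltration n} {Γ : Phase n → Idx n → Idx n → Idx n → ℝ}
    (hΓ : P.IsAdapted Γ) : metaplecticForm Γ ∈ P.formLevel 1 (-P.derivDrop - P.weightH) := by
  intro ν
  refine WeightedFiltration.weylLevel_mono (le_of_eq ?_) (hΓ (ν 0))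
  simp only [Fin.sum_univ_one]
  ring

lemma connectionForm_sub_flat (Γ : Phase n → Idx n → Idx n → Idx n → ℝ) :
    connectionForm Γ - flatConnectionForm n =
      fun x ν ↦ iOverHLaurent n * (metaplecticForm Γ + fedosovR Γ).toLaurent x ν := by
  funext x ν
  simp only [Pi.sub_apply, connectionForm, flatConnectionForm, dUGamma, fedosovGamma,
    WForm.toLaurent, metaplecticForm, Pi.add_apply, map_add, mul_add]
  abel

lemma connectionForm_eq (Γ : Phase n → Idx n → Idx n → Idx n → ℝ) :
    connectionForm Γ =
      fun x ν ↦ iOverHLaurent n * (metaplecticForm Γ + fedosovR Γ + flatGamma n).toLaurent x ν := by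
  funext x ν
  simp only [connectionForm, dUGamma, fedosovGamma,
    WForm.toLaurent, metaplecticForm, Pi.add_apply, map_add, mul_add]
  abel

variable {Γ : Phase n → Idx n → Idx n → Idx n → ℝ}

lemma metaplecticForm_add_fedosovR_mem (hΓ : IsMomAdapted S Γ) (hS : IsOpen S) :
    metaplecticForm Γ + fedosovR Γ ∈ (qFiltration S hS).formLevel 1 1 ∧
      metaplecticForm Γ + fedosovR Γ ∈ (hFiltration S hS).formLevel 1 (-2) :=
  ⟨AddSubgroup.add_mem _ (metaplecticForm_mem (hΓ.isAdapted hS)) (hΓ.fedosovR_mem hS),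
    AddSubgroup.add_mem _
      (FormFiltration.formLevel_mono (by simp [hFiltration])
        (metaplecticForm_mem (isAdapted_hFiltration Γ)))
      (FormFiltration.formLevel_mono (by norm_num) fedosovR_mem_hFiltration)⟩

theorem IsMomAdapted.qDegGT_connectionForm_sub (hΓ : IsMomAdapted S Γ) (hS : IsOpen S) :
    QDegGT S (connectionForm Γ - flatConnectionForm n) 0 := by
  have h := metaplecticForm_add_fedosovR_mem hΓ hS
  rw [connectionForm_sub_flat]
  exact qDegGT_iOverHLaurent_mul h.1 h.2 (by norm_num)

theorem IsMomAdapted.qDegGE_connectionForm (hΓ : IsMomAdapted S Γ) (hS : IsOpen S) :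
    QDegGE S (connectionForm Γ) 0 := by
  have h := metaplecticForm_add_fedosovR_mem hΓ hS
  have hq : flatGamma n ∈ (qFiltration S hS).formLevel 1 1 := flatGamma_mem fun _ ↦ rfl
  have hh : flatGamma n ∈ (hFiltration S hS).formLevel 1 (-1) := flatGamma_mem fun _ ↦ rfl
  rw [connectionForm_eq]
  refine QDegGT.qDegGE (qDegGT_iOverHLaurent_mul (d := 1) (AddSubgroup.add_mem _ h.1 hq)
    (AddSubgroup.add_mem _ (FormFiltration.formLevel_mono (by norm_num) h.2) hh) (by norm_num))

theorem IsMomAdapted.qDegGT_fedosovR_sub (hΓ : IsMomAdapted S Γ) (hS : IsOpen S) (k : ℕ) :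
    QDegGT S (fedosovR Γ - rIter Γ k).toLaurent (k - 1) :=
  qDegGT_toLaurent (AddSubgroup.sub_mem _ (hΓ.fedosovR_mem hS) (hΓ.rIter_mem hS k))
    (iterLimit_sub_mem rIter_sub_succ_mem k) (by omega)

theorem IsMomAdapted.qDegGT_hat_sub (hΓ : IsMomAdapted S Γ) (hS : IsOpen S) {N : ℕ}
    {f : Phase n → ℂ} (hf : MomPoly S (N + 1) f) (k : ℕ) :
    QDegGT S (hat Γ f - hatIter Γ f k).toLaurent (k - 2 * N) :=
  qDegGT_toLaurent (AddSubgroup.sub_mem _ (iterLimit_mem (hΓ.hatIter_mem hS hf))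
    (hΓ.hatIter_mem hS hf k)) (iterLimit_sub_mem (hatIter_sub_succ_mem f) k) (by omega)

end Bounds

end FedosovCotangent

end

theorem mainTheorem4 {n : ℕ} {Q : Type*} [TopologicalSpace Q]
    [ChartedSpace (FedosovCotangent.Model n) Q] [IsManifold (𝓡 n) ∞ Q]
    (g : FedosovCotangent.SemiRiemannianMetric n Q)
    (φ : OpenPartialHomeomorph Q (FedosovCotangent.Model n))
    (hφ : φ ∈ IsManifold.maximalAtlas (𝓡 n) ∞ Q)
    (Γ : FedosovCotangent.Phase n → FedosovCotangent.Idx n → FedosovCotangent.Idx n →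
      FedosovCotangent.Idx n → ℝ)
    (hΓ : Γ = FedosovCotangent.liftedChristoffel (g.coeffs φ))
    (S : Set (FedosovCotangent.Phase n)) (hS : S = FedosovCotangent.canonicalDomain φ) :
    FedosovCotangent.IsFormalLimitOn S (FedosovCotangent.rIter Γ)
      (FedosovCotangent.fedosovR Γ) ∧
    (∀ r, FedosovCotangent.IsFedosovSolutionOn S Γ r →
      ∀ x ∈ S, r x = FedosovCotangent.fedosovR Γ x) ∧
    FedosovCotangent.QDegGE S (FedosovCotangent.connectionForm Γ) 0 ∧
    FedosovCotangent.QDegGT S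
      (FedosovCotangent.connectionForm Γ - FedosovCotangent.flatConnectionForm n) 0 ∧
    (∀ k : ℕ, 3 ≤ k → FedosovCotangent.QDegGT S
      (FedosovCotangent.fedosovR Γ - FedosovCotangent.rIter Γ k).toLaurent ((k : ℤ) - 1)) ∧
    (∀ (N : ℕ) (f : FedosovCotangent.CotangentBundle n Q → ℂ),
      ContMDiff ((𝓡 n).prod 𝓘(ℝ, FedosovCotangent.Model n →L[ℝ] ℝ)) 𝓘(ℝ, ℂ) ∞ f →
      FedosovCotangent.IsMomentumPolynomial N f →
      FedosovCotangent.IsFormalLimitOn S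
          (FedosovCotangent.hatIter Γ (fun x ↦ f (FedosovCotangent.canonicalPoint φ x)))
          (FedosovCotangent.hat Γ (fun x ↦ f (FedosovCotangent.canonicalPoint φ x))) ∧
      (∀ a, FedosovCotangent.IsFlatLiftOn S Γ
          (fun x ↦ f (FedosovCotangent.canonicalPoint φ x)) a →
        ∀ x ∈ S, a x = FedosovCotangent.hat Γ
          (fun x ↦ f (FedosovCotangent.canonicalPoint φ x)) x) ∧
      ∀ k : ℕ, FedosovCotangent.QDegGT S
        (FedosovCotangent.hat Γ (fun x ↦ f (FedosovCotangent.canonicalPoint φ x))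
          - FedosovCotangent.hatIter Γ
              (fun x ↦ f (FedosovCotangent.canonicalPoint φ x)) k).toLaurent
        ((k : ℤ) - 2 * (N : ℤ))) := by
  have hU := φ.open_target
  have hopen : IsOpen S := by
    rw [hS]; exact FedosovCotangent.isOpen_position_preimage hU
  have hadapted : FedosovCotangent.IsMomAdapted S Γ := by
    rw [hS, hΓ]
    exact FedosovCotangent.isMomAdapted_liftedChristoffel hU (g.contDiffOn_coeffs hφ)
      fun u hu ↦ g.det_coeffs_ne_zero hφ hu
  refine ⟨FedosovCotangent.isFormalLimitOn_iterLimit (hS := hopen)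
      FedosovCotangent.rIter_sub_succ_mem,
    fun r hr x hx ↦ hr.eq_fedosovR (hS := hopen) hx, hadapted.qDegGE_connectionForm hopen,
    hadapted.qDegGT_connectionForm_sub hopen, fun k _ ↦ hadapted.qDegGT_fedosovR_sub hopen k,
    fun N f hf hpoly ↦ ⟨FedosovCotangent.isFormalLimitOn_iterLimit (hS := hopen)
      (FedosovCotangent.hatIter_sub_succ_mem _),
      fun a ha x hx ↦ ha.eq_hat (hS := hopen) hx, hadapted.qDegGT_hat_sub hopen ?_⟩⟩
  refine FedosovCotangent.momPoly_of_fibrewise hopen ?_ ?_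
  · rw [hS, ← contMDiffOn_iff_contDiffOn]
    exact hf.comp_contMDiffOn (FedosovCotangent.contMDiffOn_canonicalPoint hφ)
  · rw [hS]
    exact fun x hx ↦ hpoly.exists_eval hφ hx
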